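/- Let $m$ be a Herglotz–Nevanlinna function, that is, $m$ is analytic on $\mathbb{C}\setminus\mathbb{R}$, maps the open upper half-plane into the closed upper half-plane and satisfies $\overline{m(z)}=m(\overline{z})$ for all $z\in\mathbb{C}\setminus\mathbb{R}$. Let $\rho$ be the (unique) non-negative Borel measure on $\mathbb{R}$ with $\int_{\mathbb{R}}\frac{d\rho(\lambda)}{1+\lambda^2}<\infty$ such that, for some real $a$ and some $b\ge 0$, $$m(z)=a+bz+\int_{\mathbb{R}}\left(\frac{1}{\lambda-z}-\frac{\lambda}{1+\lambda^2}\right)d\rho(\lambda),\qquad z\in\mathbb{C}\setminus\mathbb{R}.$$ Suppose that $m$ is not a rational function, and let $K\ge 0$ be an integer. Then the moments $\int_{\mathbb{R}}\lambda^k\,d\rho(\lambda)$ exist (as absolutely convergent integrals) for all $k\in\{0,\dots,2K\}$ if and only if there are a Herglotz–Nevanlinna function $\tilde m$, an integer $N\ge 1$, non-negative constants $\upsilon_0,\dots,\upsilon_N$, real constants $\omega_0,\dots,\omega_{N-1}$ and positive constants $l_1,\dots,l_N$ with $\upsilon_n+|\omega_n|>0$ for all $n\in\{1,\dots,N-1\}$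 and $$N-1+\#\{n\in\{1,\dots,N\}\mid \upsilon_n\neq 0\}\ \ge\ K$$ such that $m$ admits the continued fraction expansion $$m(z)=\upsilon_0z+\omega_0+\cfrac{1}{-l_1z+\cfrac{1}{\upsilon_1z+\omega_1+\cfrac{1}{\;\ddots\;+\cfrac{1}{-l_Nz+\cfrac{1}{\upsilon_Nz+\tilde m(z)}}}}},\qquad z\in\mathbb{C}\setminus\mathbb{R}.$$ -/

import Mathlib

noncomputable section

/-- A Herglotz–Nevanlinna function: analytic on `ℂ \ ℝ`, maps the upper half-plane into the
closed upper half-plane, and is symmetric with respect to the real axis. Only the values on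
`ℂ \ ℝ` matter; the values on the real line are arbitrary. -/
structure IsHerglotzNevanlinna (m : ℂ → ℂ) : Prop where
  differentiableOn : DifferentiableOn ℂ m {z : ℂ | z.im ≠ 0}
  im_nonneg : ∀ z : ℂ, 0 < z.im → 0 ≤ (m z).im
  symm : ∀ z : ℂ, z.im ≠ 0 → (starRingEnd ℂ) (m z) = m ((starRingEnd ℂ) z)

/-- `m` coincides on `ℂ \ ℝ` with a quotient of polynomials without poles there. -/
def IsRationalOffReal (m : ℂ → ℂ) : Prop :=
  ∃ P Q : Polynomial ℂ, ∀ z : ℂ, z.im ≠ 0 → Q.eval z ≠ 0 ∧ m z = P.eval z / Q.eval z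

/-- The integral representation of `m` with constants `a`, `b` and Borel measure `ρ`. The
integrand is automatically `ρ`-integrable because of the growth restriction. -/
structure HasIntegralRepresentation (m : ℂ → ℂ) (a b : ℝ) (ρ : MeasureTheory.Measure ℝ) :
    Prop where
  b_nonneg : 0 ≤ b
  growth : MeasureTheory.Integrable (fun t : ℝ => 1 / (1 + t ^ 2)) ρ
  eq_integral : ∀ z : ℂ, z.im ≠ 0 →
    m z = a + b * z + ∫ t : ℝ, (1 / ((t : ℂ) - z) - (t : ℂ) / (1 + (t : ℂ) ^ 2)) ∂ρ

open Classical in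
/-- The measure `ρ` in the integral representation of `m`. For a Herglotz–Nevanlinna function
such a measure exists and is unique; the value is `0` when there is no representation. -/
def representingMeasure (m : ℂ → ℂ) : MeasureTheory.Measure ℝ :=
  if h : ∃ (ρ : MeasureTheory.Measure ℝ) (a b : ℝ), HasIntegralRepresentation m a b ρ
  then h.choose else 0

/-- The moments `∫ t ^ k dρ(t)` exist (as absolutely convergent integrals) for `k = 0, …, n`. -/
def MomentsExistUpTo (ρ : MeasureTheory.Measure ℝ) (n : ℕ) : Prop :=
  ∀ k : ℕ, k ≤ n → MeasureTheory.Integrable (fun t : ℝ => t ^ k) ρ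

/-- The part of the continued fraction that starts with `υ n * z` and has `j` further levels:
`υ n z + ω n + 1 / (-l (n+1) z + 1 / (υ (n+1) z + ω (n+1) + ⋯ ))`,
whose innermost term is `υ (n+j) z + w` (with `w` in place of `ω (n+j)`). -/
def continuedFractionFrom (υ ω l : ℕ → ℝ) (z w : ℂ) : ℕ → ℕ → ℂ
  | 0, n => υ n * z + w
  | j + 1, n => υ n * z + ω n +
      1 / (-(l (n + 1) : ℂ) * z + 1 / continuedFractionFrom υ ω l z w j (n + 1))

/-- The continued fraction with `N` levels,
`υ 0 z + ω 0 + 1 / (-l 1 z + 1 / (υ 1 z + ω 1 + ⋯ + 1 / (-l N z + 1 / (υ N z + w))))`. -/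
def continuedFraction (υ ω l : ℕ → ℝ) (N : ℕ) (z w : ℂ) : ℂ :=
  continuedFractionFrom υ ω l z w N 0

end

/-!
Everything is expressed through asymptotic expansions in powers of `1 / z`, with real coefficients,
along the positive imaginary axis; `HasRealExpansion n G` says that `G y` has such an expansion, at
`z = i y`, up to the term `z ^ (-n)`. These expansions can be added, multiplied and inverted.

The moments up to order `2 K` exist if and only if `m(z) / z` has an expansion of length `2 K + 2`
(the Hamburger–Nevanlinna theorem: `HasIntegralRepresentation.hasRealExpansion_of_moments` and
`HasIntegralRepresentation.moments_of_hasRealExpansion`). One direction is dominated convergence,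
applied repeatedly to `z ∫ t ^ j / (t - z) dρ = -∫ t ^ j dρ + ∫ t ^ (j + 1) / (t - z) dρ`. For the
other, the real parts of the remainders bound `∫ t ^ j y ^ 2 / (t ^ 2 + y ^ 2) dρ` for even `j`,
uniformly in `y`.

The continued fraction is produced by `f = υ z + ω - 1 / (l z + h)`, in which `h` is again a
Herglotz–Nevanlinna function with `h(z) / z → 0`, and which costs two terms of the expansion
(`IsHerglotzNevanlinna.exists_level`). One continues with `g = -1 / h`. If `h` has a nonzero limit
at `i ∞`, then so has `g`, and no further term is lost: the next level has `υ = 0` and `ω ≠ 0`. If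
`h` tends to `0`, then `g` grows linearly: the next level has `υ > 0`, and two more terms are lost.
So a level accounts for one or two units of `K`, as in the inequality of the theorem
(`IsHerglotzNevanlinna.exists_isContinuedFraction`). Conversely, the same terms are gained when the
levels are put back (`IsContinuedFraction.hasRealExpansion`).

That every Herglotz–Nevanlinna function has an integral representation is also proved here
(`IsHerglotzNevanlinna.exists_integralRepresentation`). On the unit disk, the Schwarz formula on
circles of radius `r < 1` represents a function with nonnegative real part by measures on the
circle, which have a limit point as `r → 1` since finite measures of bounded mass on a compact space
form a compact set. The Cayley transform carries this limit point to the real line.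
-/

open Filter Topology MeasureTheory

/-! ### Asymptotic expansions with real coefficients -/

/-- Asymptotic expansions in powers of `1 / z` with real coefficients, along `z = i y`, `y → ∞`:
`G y = c₀ + c₁ / (i y) + ⋯ + cₙ / (i y) ^ n + o(y ^ (-n))`. It is encoded recursively: `G` tends to
a real number `c`, and `i y * (G y - c)` has an expansion that is shorter by one term. -/
def HasRealExpansion : ℕ → (ℝ → ℂ) → Prop
  | 0, G => ∃ c : ℝ, Tendsto G atTop (𝓝 (c : ℂ))
  | n + 1, G => ∃ c : ℝ, HasRealExpansion n (fun y => (y * Complex.I) * (G y - c))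

namespace HasRealExpansion

lemma eventually_mul_I_ne_zero : ∀ᶠ y : ℝ in atTop, (y : ℂ) * Complex.I ≠ 0 := by
  filter_upwards [eventually_gt_atTop 0] with y hy
  simp [hy.ne']

lemma tendsto_inv_mul_I : Tendsto (fun y : ℝ => ((y : ℂ) * Complex.I)⁻¹) atTop (𝓝 0) := by
  rw [tendsto_zero_iff_norm_tendsto_zero]
  have h : Tendsto (fun y : ℝ => |y|⁻¹) atTop (𝓝 0) :=
    tendsto_inv_atTop_zero.comp tendsto_abs_atTop_atTop
  simpa using h

/-- If `i y * (G y - c)` converges, then `G` tends to `c`. -/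
lemma tendsto_of_tendsto_mul_sub {G : ℝ → ℂ} {c d : ℂ}
    (h : Tendsto (fun y : ℝ => (y * Complex.I) * (G y - c)) atTop (𝓝 d)) :
    Tendsto G atTop (𝓝 c) := by
  have h1 := (tendsto_inv_mul_I.mul h).add_const c
  rw [zero_mul, zero_add] at h1
  refine h1.congr' ?_
  filter_upwards [eventually_mul_I_ne_zero] with y hy
  rw [inv_mul_cancel_left₀ hy, sub_add_cancel]

lemma congr' {n : ℕ} {G H : ℝ → ℂ} (hG : HasRealExpansion n G) (h : G =ᶠ[atTop] H) :
    HasRealExpansion n H := by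
  induction n generalizing G H with
  | zero =>
    obtain ⟨c, hc⟩ := hG
    exact ⟨c, hc.congr' h⟩
  | succ n ih =>
    obtain ⟨c, hc⟩ := hG
    refine ⟨c, ih hc ?_⟩
    filter_upwards [h] with y hy
    rw [hy]

lemma exists_tendsto {n : ℕ} {G : ℝ → ℂ} (hG : HasRealExpansion n G) :
    ∃ c : ℝ, Tendsto G atTop (𝓝 (c : ℂ)) := by
  induction n generalizing G with
  | zero => exact hG
  | succ n ih =>
    obtain ⟨c, hc⟩ := hG
    obtain ⟨d, hd⟩ := ih hc
    exact ⟨c, tendsto_of_tendsto_mul_sub hd⟩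

/-- The constant in the recursive step is the limit. -/
lemma of_succ {n : ℕ} {G : ℝ → ℂ} {c : ℝ} (hG : HasRealExpansion (n + 1) G)
    (hc : Tendsto G atTop (𝓝 (c : ℂ))) :
    HasRealExpansion n (fun y => (y * Complex.I) * (G y - c)) := by
  obtain ⟨c', hc'⟩ := hG
  obtain ⟨d, hd⟩ := hc'.exists_tendsto
  have := tendsto_nhds_unique (tendsto_of_tendsto_mul_sub hd) hc
  rwa [this] at hc'

lemma pred {n : ℕ} {G : ℝ → ℂ} (hG : HasRealExpansion (n + 1) G) : HasRealExpansion n G := by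
  induction n generalizing G with
  | zero => exact hG.exists_tendsto
  | succ n ih =>
    obtain ⟨c, hc⟩ := hG
    exact ⟨c, ih hc⟩

lemma mono {n k : ℕ} {G : ℝ → ℂ} (hG : HasRealExpansion n G) (h : k ≤ n) :
    HasRealExpansion k G := by
  induction h with
  | refl => exact hG
  | step _ ih => exact ih hG.pred

lemma const (n : ℕ) (c : ℝ) : HasRealExpansion n (fun _ => (c : ℂ)) := by
  induction n generalizing c with
  | zero => exact ⟨c, tendsto_const_nhds⟩
  | succ n ih => exact ⟨c, by simpa using ih 0⟩

lemma add {n : ℕ} {G H : ℝ → ℂ} (hG : HasRealExpansion n G) (hH : HasRealExpansion n H) :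
    HasRealExpansion n (fun y => G y + H y) := by
  induction n generalizing G H with
  | zero =>
    obtain ⟨c, hc⟩ := hG
    obtain ⟨d, hd⟩ := hH
    exact ⟨c + d, by simpa using hc.add hd⟩
  | succ n ih =>
    obtain ⟨c, hc⟩ := hG
    obtain ⟨d, hd⟩ := hH
    refine ⟨c + d, (ih hc hd).congr' (.of_forall fun y => ?_)⟩
    push_cast
    ring

lemma mul {n : ℕ} {G H : ℝ → ℂ} (hG : HasRealExpansion n G) (hH : HasRealExpansion n H) :
    HasRealExpansion n (fun y => G y * H y) := by
  induction n generalizing G H with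
  | zero =>
    obtain ⟨c, hc⟩ := hG
    obtain ⟨d, hd⟩ := hH
    exact ⟨c * d, by simpa using hc.mul hd⟩
  | succ n ih =>
    have hG' := hG.pred
    obtain ⟨c, hc⟩ := hG
    obtain ⟨d, hd⟩ := hH
    refine ⟨c * d, ((ih hG' hd).add (ih (const n d) hc)).congr' (.of_forall fun y => ?_)⟩
    push_cast
    ring

lemma neg {n : ℕ} {G : ℝ → ℂ} (hG : HasRealExpansion n G) :
    HasRealExpansion n (fun y => -G y) :=
  ((const n (-1)).mul hG).congr' (.of_forall fun y => by simp)

lemma inv {n : ℕ} {G : ℝ → ℂ} {c : ℝ} (hG : HasRealExpansion n G)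
    (hc : Tendsto G atTop (𝓝 (c : ℂ))) (hc0 : c ≠ 0) :
    HasRealExpansion n (fun y => (G y)⁻¹) := by
  have hc0' : (c : ℂ) ≠ 0 := by exact_mod_cast hc0
  induction n with
  | zero => exact ⟨c⁻¹, by simpa using hc.inv₀ hc0'⟩
  | succ n ih =>
    refine ⟨c⁻¹, (((const n (-c⁻¹)).mul (ih hG.pred)).mul (hG.of_succ hc)).congr' ?_⟩
    filter_upwards [hc.eventually_ne hc0'] with y hy
    push_cast
    field_simp
    ring

lemma div_mul_I {n : ℕ} {G : ℝ → ℂ} (hG : HasRealExpansion n G) :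
    HasRealExpansion (n + 1) (fun y => G y / (y * Complex.I)) := by
  refine ⟨0, hG.congr' ?_⟩
  filter_upwards [eventually_mul_I_ne_zero] with y hy
  rw [Complex.ofReal_zero, sub_zero, mul_div_cancel₀ _ hy]

end HasRealExpansion

/-! ### The kernel of the integral representation -/

lemma ofReal_sub_ne_zero {z : ℂ} (hz : z.im ≠ 0) (t : ℝ) : (t : ℂ) - z ≠ 0 := by
  intro h
  apply hz
  simpa using congrArg Complex.im h

lemma norm_inv_ofReal_sub_le {z : ℂ} (hz : z.im ≠ 0) (t : ℝ) :
    ‖((t : ℂ) - z)⁻¹‖ ≤ |z.im|⁻¹ := by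
  rw [norm_inv]
  refine inv_anti₀ (abs_pos.mpr hz) ?_
  simpa using Complex.abs_im_le_norm ((t : ℂ) - z)

lemma one_add_ofReal_sq_ne_zero (t : ℝ) : (1 + (t : ℂ) ^ 2) ≠ 0 := by
  exact_mod_cast (by positivity : (1 + t ^ 2 : ℝ) ≠ 0)

lemma herglotzKernel_eq {z : ℂ} (hz : z.im ≠ 0) (t : ℝ) :
    1 / ((t : ℂ) - z) - (t : ℂ) / (1 + (t : ℂ) ^ 2) =
      (z + (1 + z ^ 2) * ((t : ℂ) - z)⁻¹) * ((1 / (1 + t ^ 2) : ℝ) : ℂ) := by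
  have h1 := ofReal_sub_ne_zero hz t
  have h2 := one_add_ofReal_sq_ne_zero t
  push_cast
  field_simp
  ring

lemma norm_herglotzKernel_le {z : ℂ} (hz : z.im ≠ 0) (t : ℝ) :
    ‖1 / ((t : ℂ) - z) - (t : ℂ) / (1 + (t : ℂ) ^ 2)‖ ≤
      (‖z‖ + ‖1 + z ^ 2‖ * |z.im|⁻¹) * (1 / (1 + t ^ 2)) := by
  rw [herglotzKernel_eq hz, norm_mul, Complex.norm_real, Real.norm_of_nonneg (by positivity)]
  gcongr
  refine (norm_add_le _ _).trans ?_
  rw [norm_mul]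
  gcongr
  exact norm_inv_ofReal_sub_le hz t

lemma integrable_herglotzKernel {ρ : Measure ℝ} (hρ : Integrable (fun t : ℝ => 1 / (1 + t ^ 2)) ρ)
    {z : ℂ} (hz : z.im ≠ 0) :
    Integrable (fun t : ℝ => 1 / ((t : ℂ) - z) - (t : ℂ) / (1 + (t : ℂ) ^ 2)) ρ := by
  refine Integrable.mono' (hρ.const_mul (‖z‖ + ‖1 + z ^ 2‖ * |z.im|⁻¹)) ?_ ?_
  · exact (by fun_prop : Measurable _).aestronglyMeasurable
  · exact .of_forall (norm_herglotzKernel_le hz)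

lemma herglotzKernel_im (z : ℂ) (t : ℝ) :
    (1 / ((t : ℂ) - z) - (t : ℂ) / (1 + (t : ℂ) ^ 2)).im = z.im / Complex.normSq (t - z) := by
  have h : (t : ℂ) / (1 + (t : ℂ) ^ 2) = ((t / (1 + t ^ 2) : ℝ) : ℂ) := by push_cast; rfl
  rw [h, Complex.sub_im, Complex.ofReal_im, one_div, Complex.inv_im]
  simp

lemma tendsto_inv_ofReal_sub_mul_I (t : ℝ) :
    Tendsto (fun y : ℝ => ((t : ℂ) - y * Complex.I)⁻¹) atTop (𝓝 0) := by
  refine squeeze_zero_norm' ?_ tendsto_inv_atTop_zero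
  filter_upwards [eventually_gt_atTop 0] with y hy
  have := norm_inv_ofReal_sub_le (z := y * Complex.I) (by simpa using hy.ne') t
  simpa [abs_of_pos hy] using this

/-! ### Consequences of the integral representation -/

namespace HasIntegralRepresentation

variable {m : ℂ → ℂ} {a b : ℝ} {ρ : Measure ℝ}

lemma im_eq (h : HasIntegralRepresentation m a b ρ) {z : ℂ} (hz : z.im ≠ 0) :
    (m z).im = b * z.im + ∫ t : ℝ, z.im / Complex.normSq (t - z) ∂ρ := by
  rw [h.eq_integral z hz]
  have := integral_im (integrable_herglotzKernel h.growth hz)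
  simp only [RCLike.im_to_complex, herglotzKernel_im] at this
  simp [this]

lemma integrable_im (h : HasIntegralRepresentation m a b ρ) {z : ℂ} (hz : z.im ≠ 0) :
    Integrable (fun t : ℝ => z.im / Complex.normSq (t - z)) ρ := by
  have := (integrable_herglotzKernel h.growth hz).im
  simpa only [RCLike.im_to_complex, herglotzKernel_im] using this

/-- The constant `b` is the angular derivative of `m` at `i ∞`. -/
lemma tendsto_div (h : HasIntegralRepresentation m a b ρ) :
    Tendsto (fun y : ℝ => m (y * Complex.I) / (y * Complex.I)) atTop (𝓝 (b : ℂ)) := by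
  have key : Tendsto (fun y : ℝ => ∫ t : ℝ, ((1 / ((t : ℂ) - y * Complex.I)
      - (t : ℂ) / (1 + (t : ℂ) ^ 2)) / (y * Complex.I)) ∂ρ) atTop (𝓝 (∫ _ : ℝ, 0 ∂ρ)) := by
    refine tendsto_integral_filter_of_dominated_convergence (fun t => 3 * (1 / (1 + t ^ 2)))
      ?_ ?_ (h.growth.const_mul 3) ?_
    · exact .of_forall fun y => (by fun_prop : Measurable _).aestronglyMeasurable
    · filter_upwards [eventually_ge_atTop 1] with y hy
      refine .of_forall fun t => ?_
      have hy0 : 0 < y := by linarith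
      have hz : ((y : ℂ) * Complex.I).im ≠ 0 := by simpa using hy0.ne'
      have h1 := norm_herglotzKernel_le hz t
      have h2 : ‖(1 : ℂ) + (y * Complex.I) ^ 2‖ ≤ 1 + y ^ 2 := by
        refine (norm_add_le _ _).trans ?_
        simp [abs_of_pos hy0]
      have h3 : ‖(y : ℂ) * Complex.I‖ = y := by simp [abs_of_pos hy0]
      have h4 : |((y : ℂ) * Complex.I).im| = y := by simp [abs_of_pos hy0]
      rw [norm_div, h3, div_le_iff₀ hy0]
      rw [h3, h4] at h1
      refine h1.trans ?_
      have h5 : y + ‖(1 : ℂ) + (y * Complex.I) ^ 2‖ * y⁻¹ ≤ 3 * y := by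
        have : ‖(1 : ℂ) + (y * Complex.I) ^ 2‖ * y⁻¹ ≤ 2 * y := by
          rw [← div_eq_mul_inv, div_le_iff₀ hy0]
          nlinarith
        linarith
      calc _ ≤ 3 * y * (1 / (1 + t ^ 2)) := by gcongr
        _ = _ := by ring
    · refine .of_forall fun t => ?_
      have := ((tendsto_inv_ofReal_sub_mul_I t).sub_const ((t : ℂ) / (1 + (t : ℂ) ^ 2))).mul
        HasRealExpansion.tendsto_inv_mul_I
      simpa [div_eq_mul_inv] using this
  have h1 := ((HasRealExpansion.tendsto_inv_mul_I.const_mul (a : ℂ)).add_const (b : ℂ)).add key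
  simp only [mul_zero, zero_add, integral_zero, add_zero] at h1
  refine h1.congr' ?_
  filter_upwards [eventually_gt_atTop 0] with y hy
  have hz : ((y : ℂ) * Complex.I).im ≠ 0 := by simpa using hy.ne'
  have hz' : (y : ℂ) * Complex.I ≠ 0 := by intro h; simp [h] at hz
  rw [h.eq_integral _ hz, integral_div]
  rw [add_div, add_div, mul_div_cancel_right₀ _ hz', div_eq_mul_inv (a : ℂ)]

end HasIntegralRepresentation

/-! ### The Hamburger–Nevanlinna theorem -/

/-- The Cauchy transform `∫ t ^ j / (t - z) dρ(t)` of the signed measure `t ^ j dρ(t)`. -/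
noncomputable def momentTransform (ρ : Measure ℝ) (j : ℕ) (z : ℂ) : ℂ :=
  ∫ t : ℝ, (t : ℂ) ^ j * ((t : ℂ) - z)⁻¹ ∂ρ

section momentTransform

variable {ρ : Measure ℝ} {j : ℕ}

lemma integrable_momentTransform (h : Integrable (fun t : ℝ => t ^ j) ρ) {z : ℂ} (hz : z.im ≠ 0) :
    Integrable (fun t : ℝ => (t : ℂ) ^ j * ((t : ℂ) - z)⁻¹) ρ := by
  refine Integrable.mono' (h.norm.mul_const |z.im|⁻¹)
    (by fun_prop : Measurable _).aestronglyMeasurable (.of_forall fun t => ?_)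
  rw [norm_mul, norm_pow, norm_pow, Complex.norm_real]
  gcongr
  exact norm_inv_ofReal_sub_le hz t

/-- Since `t / (t - z) = 1 + z / (t - z)`, the transform with one more power of `t` costs one
power of `z` and one moment. -/
lemma momentTransform_succ (h : Integrable (fun t : ℝ => t ^ j) ρ) {z : ℂ} (hz : z.im ≠ 0) :
    momentTransform ρ (j + 1) z = z * momentTransform ρ j z + ((∫ t : ℝ, t ^ j ∂ρ : ℝ) : ℂ) := by
  have h1 : ((∫ t : ℝ, t ^ j ∂ρ : ℝ) : ℂ) = ∫ t : ℝ, (t : ℂ) ^ j ∂ρ := by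
    rw [← integral_complex_ofReal]
    simp
  have h2 : Integrable (fun t : ℝ => (t : ℂ) ^ j) ρ := by simpa using h.ofReal (𝕜 := ℂ)
  rw [h1, momentTransform, momentTransform, ← integral_const_mul,
    ← integral_add ((integrable_momentTransform h hz).const_mul z) h2]
  congr 1 with t
  have := ofReal_sub_ne_zero hz t
  field_simp
  ring

lemma integrable_momentTransform_succ (h : Integrable (fun t : ℝ => t ^ j) ρ) {z : ℂ}
    (hz : z.im ≠ 0) :
    Integrable (fun t : ℝ => (t : ℂ) ^ (j + 1) * ((t : ℂ) - z)⁻¹) ρ := by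
  have h2 : Integrable (fun t : ℝ => (t : ℂ) ^ j) ρ := by simpa using h.ofReal (𝕜 := ℂ)
  refine (((integrable_momentTransform h hz).const_mul z).add h2).congr (.of_forall fun t => ?_)
  have := ofReal_sub_ne_zero hz t
  simp only [Pi.add_apply]
  field_simp
  ring

lemma tendsto_mul_momentTransform (h : Integrable (fun t : ℝ => t ^ j) ρ) :
    Tendsto (fun y : ℝ => (y * Complex.I) * momentTransform ρ j (y * Complex.I)) atTop
      (𝓝 ((-∫ t : ℝ, t ^ j ∂ρ : ℝ) : ℂ)) := by
  have h1 : ((-∫ t : ℝ, t ^ j ∂ρ : ℝ) : ℂ) = ∫ t : ℝ, -(t : ℂ) ^ j ∂ρ := by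
    rw [integral_neg, Complex.ofReal_neg, ← integral_complex_ofReal]
    simp
  simp only [momentTransform, ← integral_const_mul, h1]
  refine tendsto_integral_filter_of_dominated_convergence (fun t => ‖t ^ j‖) ?_ ?_ h.norm ?_
  · exact .of_forall fun y => (by fun_prop : Measurable _).aestronglyMeasurable
  · filter_upwards [eventually_gt_atTop 0] with y hy
    refine .of_forall fun t => ?_
    have hz : ((y : ℂ) * Complex.I).im ≠ 0 := by simpa using hy.ne'
    have h2 := norm_inv_ofReal_sub_le hz t
    have h4 : |((y : ℂ) * Complex.I).im| = y := by simp [abs_of_pos hy]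
    rw [h4] at h2
    rw [norm_mul, norm_mul, norm_mul, norm_pow, norm_pow, Complex.norm_real]
    calc _ = ‖t‖ ^ j * (y * ‖((t : ℂ) - y * Complex.I)⁻¹‖) := by simp [abs_of_pos hy]; ring
      _ ≤ ‖t‖ ^ j * (y * y⁻¹) := by gcongr
      _ = ‖t‖ ^ j := by rw [mul_inv_cancel₀ hy.ne', mul_one]
  · refine .of_forall fun t => ?_
    have h2 := (((tendsto_inv_ofReal_sub_mul_I t).const_mul (t : ℂ)).sub_const 1).const_mul
      ((t : ℂ) ^ j)
    rw [mul_zero, zero_sub, mul_neg, mul_one] at h2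
    refine h2.congr' ?_
    filter_upwards [eventually_gt_atTop 0] with y hy
    have := ofReal_sub_ne_zero (z := y * Complex.I) (by simpa using hy.ne') t
    field_simp
    ring

/-- Existing moments give an expansion of the Cauchy transform. -/
lemma hasRealExpansion_momentTransform (n : ℕ)
    (h : ∀ k, j ≤ k → k ≤ j + n → Integrable (fun t : ℝ => t ^ k) ρ) :
    HasRealExpansion n (fun y : ℝ => (y * Complex.I) * momentTransform ρ j (y * Complex.I)) := by
  induction n generalizing j with
  | zero => exact ⟨_, tendsto_mul_momentTransform (h j le_rfl le_rfl)⟩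
  | succ n ih =>
    refine ⟨-∫ t : ℝ, t ^ j ∂ρ, (ih (j := j + 1) fun k hk hk' =>
      h k (by omega) (by omega)).congr' ?_⟩
    filter_upwards [eventually_gt_atTop 0] with y hy
    rw [momentTransform_succ (h j le_rfl (by omega)) (by simpa using hy.ne')]
    push_cast
    ring

/-- A nonnegative function is integrable if its truncations by `y ^ 2 / (t ^ 2 + y ^ 2)` have
bounded integrals. -/
lemma integrable_of_truncation_bounded {f : ℝ → ℝ} (hf : Measurable f) (hf0 : ∀ t, 0 ≤ f t)
    (hi : ∀ y : ℝ, 0 < y → Integrable (fun t => f t * (y ^ 2 / (t ^ 2 + y ^ 2))) ρ) {C : ℝ}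
    (hC : ∀ᶠ y : ℝ in atTop, ∫ t, f t * (y ^ 2 / (t ^ 2 + y ^ 2)) ∂ρ ≤ C) : Integrable f ρ := by
  have hcov : AECover ρ (atTop : Filter ℕ) fun n : ℕ => Set.Icc (-((n : ℝ) + 1)) ((n : ℝ) + 1) :=
    aecover_Icc (tendsto_neg_atTop_atBot.comp (tendsto_atTop_add_const_right _ 1
      tendsto_natCast_atTop_atTop)) (tendsto_atTop_add_const_right _ 1 tendsto_natCast_atTop_atTop)
  have hle : ∀ n : ℕ, ∀ t ∈ Set.Icc (-((n : ℝ) + 1)) ((n : ℝ) + 1),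
      f t ≤ 2 * (f t * (((n : ℝ) + 1) ^ 2 / (t ^ 2 + ((n : ℝ) + 1) ^ 2))) := by
    intro n t ht
    have h1 : t ^ 2 ≤ ((n : ℝ) + 1) ^ 2 := sq_le_sq' ht.1 ht.2
    have h2 : 1 / 2 ≤ ((n : ℝ) + 1) ^ 2 / (t ^ 2 + ((n : ℝ) + 1) ^ 2) := by
      rw [div_le_div_iff₀ (by norm_num) (by positivity)]
      linarith
    nlinarith [hf0 t]
  have hint : ∀ n : ℕ, IntegrableOn f (Set.Icc (-((n : ℝ) + 1)) ((n : ℝ) + 1)) ρ := by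
    intro n
    refine Integrable.mono' ((hi ((n : ℝ) + 1) (by positivity)).const_mul 2).integrableOn
      hf.aestronglyMeasurable ?_
    filter_upwards [ae_restrict_mem measurableSet_Icc] with t ht
    rw [Real.norm_of_nonneg (hf0 t)]
    exact hle n t ht
  refine hcov.integrable_of_integral_bounded_of_nonneg_ae (2 * C) hint (.of_forall hf0) ?_
  have htend : Tendsto (fun n : ℕ => (n : ℝ) + 1) atTop atTop :=
    tendsto_atTop_add_const_right _ 1 tendsto_natCast_atTop_atTop
  filter_upwards [htend.eventually hC] with n hn
  have hi' := (hi ((n : ℝ) + 1) (by positivity)).const_mul 2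
  calc _ ≤ ∫ t in Set.Icc (-((n : ℝ) + 1)) ((n : ℝ) + 1),
        2 * (f t * (((n : ℝ) + 1) ^ 2 / (t ^ 2 + ((n : ℝ) + 1) ^ 2))) ∂ρ :=
        setIntegral_mono_on (hint n) hi'.integrableOn measurableSet_Icc (hle n)
    _ ≤ ∫ t, 2 * (f t * (((n : ℝ) + 1) ^ 2 / (t ^ 2 + ((n : ℝ) + 1) ^ 2))) ∂ρ :=
        setIntegral_le_integral hi' (.of_forall fun t => by have := hf0 t; positivity)
    _ ≤ 2 * C := by
        rw [integral_const_mul]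
        linarith

end momentTransform

section

variable {ρ : Measure ℝ} {j : ℕ}

lemma integrable_pow_succ_of_even (hj : Even j) (h : Integrable (fun t : ℝ => t ^ j) ρ)
    (h2 : Integrable (fun t : ℝ => t ^ (j + 2)) ρ) : Integrable (fun t : ℝ => t ^ (j + 1)) ρ := by
  refine Integrable.mono' (h.add h2) (by fun_prop : Measurable _).aestronglyMeasurable
    (.of_forall fun t => ?_)
  have h0 : 0 ≤ t ^ j := hj.pow_nonneg t
  rw [Real.norm_eq_abs, pow_succ, abs_mul, abs_of_nonneg h0, Pi.add_apply, pow_add]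
  have : |t| ≤ 1 + t ^ 2 := by
    rw [abs_le]
    constructor <;> nlinarith
  nlinarith

/-- If the Cauchy transform of `t ^ j dρ(t)` (`j` even) has an expansion, then moments exist: the
expansion bounds the integrals of `t ^ (j + 2) y ^ 2 / (t ^ 2 + y ^ 2)`, which are real parts. -/
lemma integrable_pow_of_hasRealExpansion (K : ℕ) (hj : Even j)
    (h : Integrable (fun t : ℝ => t ^ j) ρ)
    (hE : HasRealExpansion (2 * K)
      (fun y : ℝ => (y * Complex.I) * momentTransform ρ j (y * Complex.I))) :
    ∀ k, j ≤ k → k ≤ j + 2 * K → Integrable (fun t : ℝ => t ^ k) ρ := by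
  induction K generalizing j with
  | zero =>
    intro k hk hk'
    obtain rfl : k = j := by omega
    exact h
  | succ K ih =>
    have hsucc : ∀ {i : ℕ}, Integrable (fun t : ℝ => t ^ i) ρ → ∀ᶠ y : ℝ in atTop,
        (y * Complex.I) * ((y * Complex.I) * momentTransform ρ i (y * Complex.I) -
          ((-∫ t : ℝ, t ^ i ∂ρ : ℝ) : ℂ)) =
        (y * Complex.I) * momentTransform ρ (i + 1) (y * Complex.I) := by
      intro i hi
      filter_upwards [eventually_gt_atTop 0] with y hy
      rw [momentTransform_succ hi (by simpa using hy.ne')]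
      push_cast
      ring
    have hE1 : HasRealExpansion (2 * K + 1)
        (fun y : ℝ => (y * Complex.I) * momentTransform ρ (j + 1) (y * Complex.I)) :=
      (hE.of_succ (tendsto_mul_momentTransform h)).congr' (hsucc h)
    -- The term `d / z` of the expansion is imaginary as `d` is real, so it does not affect the
    -- real part, which is the truncated moment of order `j + 2`.
    have h2 : Integrable (fun t : ℝ => t ^ (j + 2)) ρ := by
      obtain ⟨d, hd⟩ := hE1
      obtain ⟨e, he⟩ := hd.exists_tendsto
      have he' := (Complex.continuous_re.tendsto _).comp he
      have hform : ∀ y : ℝ, 0 < y →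
          Integrable (fun t : ℝ => t ^ (j + 2) * (y ^ 2 / (t ^ 2 + y ^ 2))) ρ ∧
          ∫ t : ℝ, t ^ (j + 2) * (y ^ 2 / (t ^ 2 + y ^ 2)) ∂ρ = -((y * Complex.I) *
            ((y * Complex.I) * momentTransform ρ (j + 1) (y * Complex.I) - (d : ℂ))).re := by
        intro y hy
        have hz : ((y : ℂ) * Complex.I).im ≠ 0 := by simpa using hy.ne'
        have hi := integrable_momentTransform_succ h hz
        have hre := integral_re hi
        have hir := hi.re
        have hk : ∀ t : ℝ, RCLike.re ((t : ℂ) ^ (j + 1) * ((t : ℂ) - y * Complex.I)⁻¹) =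
            t ^ (j + 2) * (y ^ 2 / (t ^ 2 + y ^ 2)) * (y ^ 2)⁻¹ := by
          intro t
          have h3 : (t : ℂ) ^ (j + 1) = ((t ^ (j + 1) : ℝ) : ℂ) := by push_cast; rfl
          rw [RCLike.re_to_complex, h3, Complex.re_ofReal_mul, Complex.inv_re]
          simp only [Complex.normSq_apply, Complex.sub_re, Complex.ofReal_re, Complex.mul_re,
            Complex.I_re, Complex.ofReal_im, Complex.I_im, Complex.sub_im, Complex.mul_im]
          have : t ^ 2 + y ^ 2 ≠ 0 := by positivity
          have h4 : (t - (y * 0 - 0 * 1)) * (t - (y * 0 - 0 * 1)) +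
            (0 - (y * 1 + 0 * 0)) * (0 - (y * 1 + 0 * 0)) = t ^ 2 + y ^ 2 := by ring
          rw [h4]
          field_simp
          ring
        simp only [hk] at hre hir
        have hy2 : y ^ 2 ≠ 0 := by positivity
        constructor
        · refine (hir.mul_const (y ^ 2)).congr (.of_forall fun t => ?_)
          simp only
          rw [inv_mul_cancel_right₀ hy2]
        · rw [integral_mul_const] at hre
          have hS : (momentTransform ρ (j + 1) (y * Complex.I)).re =
            (∫ t : ℝ, t ^ (j + 2) * (y ^ 2 / (t ^ 2 + y ^ 2)) ∂ρ) * (y ^ 2)⁻¹ := hre.symm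
          rw [← mul_inv_cancel_right₀ hy2 (∫ t : ℝ, t ^ (j + 2) * (y ^ 2 / (t ^ 2 + y ^ 2)) ∂ρ),
            mul_right_comm, ← hS]
          simp only [Complex.mul_re, Complex.mul_im, Complex.sub_re, Complex.sub_im,
            Complex.ofReal_re, Complex.ofReal_im, Complex.I_re, Complex.I_im]
          ring
      refine integrable_of_truncation_bounded (C := -e + 1) (by fun_prop)
        (fun t => (hj.add even_two).pow_nonneg t) (fun y hy => (hform y hy).1) ?_
      filter_upwards [he'.eventually (lt_mem_nhds (sub_one_lt _)), eventually_gt_atTop 0] with y h1 h2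
      rw [(hform y h2).2]
      simp only [Function.comp, Complex.ofReal_re] at h1
      linarith
    have h1 := integrable_pow_succ_of_even hj h h2
    have hE2 : HasRealExpansion (2 * K)
        (fun y : ℝ => (y * Complex.I) * momentTransform ρ (j + 2) (y * Complex.I)) :=
      (hE1.of_succ (tendsto_mul_momentTransform h1)).congr' (hsucc h1)
    intro k hk hk'
    rcases (by omega : k = j ∨ k = j + 1 ∨ j + 2 ≤ k) with rfl | rfl | hk2
    · exact h
    · exact h1
    · exact ih (hj.add even_two) h2 hE2 k hk2 (by omega)

end

namespace HasIntegralRepresentation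

variable {m : ℂ → ℂ} {a b : ℝ} {ρ : Measure ℝ}

/-- If `ρ` is finite, then `m z = b z + ω + ∫ 1 / (t - z) dρ(t)` for a real constant `ω`. -/
lemma eq_add_momentTransform (h : HasIntegralRepresentation m a b ρ)
    (hρ : Integrable (fun t : ℝ => t ^ 0) ρ) :
    ∃ ω : ℝ, ∀ z : ℂ, z.im ≠ 0 → m z = b * z + ω + momentTransform ρ 0 z := by
  have hρ' : Integrable (fun t : ℝ => t / (1 + t ^ 2)) ρ := by
    refine hρ.mono' (by fun_prop : Measurable _).aestronglyMeasurable (.of_forall fun t => ?_)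
    rw [Real.norm_eq_abs, abs_div, abs_of_pos (by positivity : 0 < 1 + t ^ 2),
      div_le_iff₀ (by positivity), pow_zero, one_mul, abs_le]
    constructor <;> nlinarith
  refine ⟨a - ∫ t : ℝ, t / (1 + t ^ 2) ∂ρ, fun z hz => ?_⟩
  have h1 := integrable_momentTransform hρ hz
  have h2 := hρ'.ofReal (𝕜 := ℂ)
  have h3 : ∫ t : ℝ, (1 / ((t : ℂ) - z) - (t : ℂ) / (1 + (t : ℂ) ^ 2)) ∂ρ =
      momentTransform ρ 0 z - ((∫ t : ℝ, t / (1 + t ^ 2) ∂ρ : ℝ) : ℂ) := by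
    rw [momentTransform, ← integral_complex_ofReal]
    refine Eq.trans ?_ (integral_sub h1 h2)
    congr 1 with t
    simp
  rw [h.eq_integral z hz, h3]
  push_cast
  ring

lemma hasRealExpansion_of_moments (h : HasIntegralRepresentation m a b ρ) {K : ℕ}
    (hK : MomentsExistUpTo ρ (2 * K)) :
    HasRealExpansion (2 * K + 2) (fun y : ℝ => m (y * Complex.I) / (y * Complex.I)) := by
  obtain ⟨ω, hω⟩ := h.eq_add_momentTransform (hK 0 (Nat.zero_le _))
  have h0 := hasRealExpansion_momentTransform (ρ := ρ) (j := 0) (2 * K)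
    fun k _ hk => hK k (by simpa using hk)
  refine ⟨b, ω, h0.congr' ?_⟩
  filter_upwards [eventually_gt_atTop 0] with y hy
  have hz : ((y : ℂ) * Complex.I).im ≠ 0 := by simpa using hy.ne'
  have hz' : (y : ℂ) * Complex.I ≠ 0 := by intro h; simp [h] at hz
  rw [hω _ hz, mul_sub ((y : ℂ) * Complex.I) (_ / _), mul_div_cancel₀ _ hz']
  ring

lemma moments_of_hasRealExpansion (h : HasIntegralRepresentation m a b ρ) {K : ℕ}
    (hE : HasRealExpansion (2 * K + 2) (fun y : ℝ => m (y * Complex.I) / (y * Complex.I))) :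
    MomentsExistUpTo ρ (2 * K) := by
  have hE1 := hE.of_succ h.tendsto_div
  -- The zeroth moment exists since `y * Im (m(iy) - b i y)` is bounded.
  have hρ : Integrable (fun t : ℝ => t ^ 0) ρ := by
    obtain ⟨ω, hω⟩ := hE1
    obtain ⟨d, hd⟩ := hω.exists_tendsto
    have hd' := (Complex.continuous_re.tendsto _).comp hd
    have hform : ∀ y : ℝ, 0 < y →
        Integrable (fun t : ℝ => t ^ 0 * (y ^ 2 / (t ^ 2 + y ^ 2))) ρ ∧
        ∫ t : ℝ, t ^ 0 * (y ^ 2 / (t ^ 2 + y ^ 2)) ∂ρ = -((y * Complex.I) *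
            ((y * Complex.I) * (m (y * Complex.I) / (y * Complex.I) - (b : ℂ)) - (ω : ℂ))).re := by
      intro y hy
      have hz : ((y : ℂ) * Complex.I).im ≠ 0 := by simpa using hy.ne'
      have hz' : (y : ℂ) * Complex.I ≠ 0 := by intro h; simp [h] at hz
      have hi := (h.integrable_im hz).const_mul y
      have him := h.im_eq hz
      have hk : ∀ t : ℝ, y * (((y : ℂ) * Complex.I).im / Complex.normSq (t - y * Complex.I)) =
          t ^ 0 * (y ^ 2 / (t ^ 2 + y ^ 2)) := by
        intro t
        simp [Complex.normSq_apply]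
        ring
      simp only [hk] at hi
      refine ⟨hi, ?_⟩
      simp only [← hk]
      rw [integral_const_mul, mul_sub ((y : ℂ) * Complex.I) (_ / _), mul_div_cancel₀ _ hz']
      generalize ∫ t : ℝ, ((y : ℂ) * Complex.I).im / Complex.normSq (t - y * Complex.I) ∂ρ = J
        at him ⊢
      simp only [Complex.mul_re, Complex.mul_im, Complex.sub_re, Complex.sub_im,
        Complex.ofReal_re, Complex.ofReal_im, Complex.I_re, Complex.I_im] at him ⊢
      rw [him]
      ring
    refine integrable_of_truncation_bounded (C := -d + 1) (by fun_prop)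
      (fun t => by simp) (fun y hy => (hform y hy).1) ?_
    filter_upwards [hd'.eventually (lt_mem_nhds (sub_one_lt _)), eventually_gt_atTop 0] with y h1 h2
    rw [(hform y h2).2]
    simp only [Function.comp, Complex.ofReal_re] at h1
    linarith
  obtain ⟨ω, hω⟩ := h.eq_add_momentTransform hρ
  have h0 := tendsto_mul_momentTransform hρ
  have h1 : Tendsto (fun y : ℝ => momentTransform ρ 0 (y * Complex.I)) atTop (𝓝 0) :=
    HasRealExpansion.tendsto_of_tendsto_mul_sub (by simpa using h0)
  have heq : ∀ᶠ y : ℝ in atTop,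
      (y * Complex.I) * (m (y * Complex.I) / (y * Complex.I) - (b : ℂ)) =
        ω + momentTransform ρ 0 (y * Complex.I) := by
    filter_upwards [eventually_gt_atTop 0] with y hy
    have hz : ((y : ℂ) * Complex.I).im ≠ 0 := by simpa using hy.ne'
    have hz' : (y : ℂ) * Complex.I ≠ 0 := by intro h; simp [h] at hz
    rw [hω _ hz, mul_sub, mul_div_cancel₀ _ hz']
    ring
  have hE2 : HasRealExpansion (2 * K)
      (fun y : ℝ => (y * Complex.I) * momentTransform ρ 0 (y * Complex.I)) := by
    refine ((hE1.congr' heq).of_succ (c := ω) (by simpa using h1.const_add (ω : ℂ))).congr'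
      (.of_forall fun y => ?_)
    ring
  intro k hk
  exact integrable_pow_of_hasRealExpansion K (by simp) hρ hE2 k (Nat.zero_le _) (by simpa using hk)

end HasIntegralRepresentation

/-! ### The Herglotz–Riesz theorem on the disk -/

/-- On the unit circle, `g(ζ) |dζ| / 2π` is a finite measure. -/
lemma exists_finiteMeasure_circleAverage {g : ℂ → ℝ} (hg : ContinuousOn g (Metric.sphere 0 1))
    (hg0 : ∀ ζ ∈ Metric.sphere (0 : ℂ) 1, 0 ≤ g ζ) :
    ∃ μ : FiniteMeasure (Metric.sphere (0 : ℂ) 1), ∀ φ : ℂ → ℂ,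
      ContinuousOn φ (Metric.sphere 0 1) →
      ∫ ζ, φ ζ ∂(μ : Measure (Metric.sphere (0 : ℂ) 1)) =
        Real.circleAverage (fun ζ => (g ζ : ℂ) * φ ζ) 0 1 := by
  have hmem : ∀ θ : ℝ, circleMap 0 1 θ ∈ Metric.sphere (0 : ℂ) 1 :=
    fun θ => circleMap_mem_sphere 0 zero_le_one θ
  set e : ℝ → Metric.sphere (0 : ℂ) 1 := fun θ => ⟨circleMap 0 1 θ, hmem θ⟩ with he
  have hec : Continuous e := (continuous_circleMap 0 1).subtype_mk _
  set d : ℝ → ℝ := fun θ => (2 * Real.pi)⁻¹ * g (circleMap 0 1 θ) with hd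
  have hdc : Continuous d :=
    continuous_const.mul (hg.comp_continuous (continuous_circleMap 0 1) hmem)
  have hd0 : ∀ θ, 0 ≤ d θ := fun θ => mul_nonneg (by positivity) (hg0 _ (hmem θ))
  set μ₀ : Measure ℝ := volume.restrict (Set.Ioc 0 (2 * Real.pi)) with hμ₀
  have hfin : IsFiniteMeasure (μ₀.withDensity fun θ => ENNReal.ofReal (d θ)) :=
    isFiniteMeasure_withDensity_ofReal (hdc.integrableOn_Ioc.2)
  refine ⟨⟨(μ₀.withDensity fun θ => ENNReal.ofReal (d θ)).map e, inferInstance⟩, fun φ hφ => ?_⟩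
  have hφc : Continuous fun ζ : Metric.sphere (0 : ℂ) 1 => φ ζ :=
    continuousOn_iff_continuous_domRestrict.mp hφ
  rw [FiniteMeasure.toMeasure_mk, integral_map hec.aemeasurable hφc.aestronglyMeasurable,
    integral_withDensity_eq_integral_toReal_smul (by fun_prop) (by simp),
    Real.circleAverage_def, intervalIntegral.integral_of_le (by positivity), ← integral_smul]
  congr 1 with θ
  rw [ENNReal.toReal_ofReal (hd0 θ)]
  simp [hd, he]
  ring

/-- The product of a real part with a complex number in terms of a product that is analytic in the
first factor and the conjugate of another one. -/
lemma ofReal_re_mul_eq (x H : ℂ) : (x.re : ℂ) * H =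
    (2⁻¹ : ℝ) • (x * H + Complex.conjCLE.toContinuousLinearMap
      ((2 : ℝ) • ((H.re : ℂ) * x) - x * H)) := by
  apply Complex.ext
  · simp
    ring
  · simp
    ring

/-- The Schwarz integral formula: an analytic function is recovered from its real part on the
boundary circle. -/
lemma circleAverage_re_mul_herglotzKernel {F : ℂ → ℂ} (hF : DiffContOnCl ℂ F (Metric.ball 0 1))
    {w : ℂ} (hw : w ∈ Metric.ball (0 : ℂ) 1) :
    Real.circleAverage (fun ζ => ((F ζ).re : ℂ) * ((ζ + w) / (ζ - w))) 0 1 =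
      F w - Complex.I * (F 0).im := by
  have hFc : ContinuousOn F (Metric.sphere 0 1) :=
    hF.continuousOn_ball.mono Metric.sphere_subset_closedBall
  have hne : ∀ ζ ∈ Metric.sphere (0 : ℂ) 1, ζ - w ≠ 0 := by
    intro ζ hζ h
    rw [sub_eq_zero] at h
    subst h
    simp at hw hζ
    linarith
  have hHc : ContinuousOn (fun ζ : ℂ => (ζ + w) / (ζ - w)) (Metric.sphere 0 1) :=
    ContinuousOn.div (by fun_prop) (by fun_prop) hne
  have hHrc : ContinuousOn (fun ζ : ℂ => (((ζ + w) / (ζ - w)).re : ℂ)) (Metric.sphere 0 1) :=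
    Complex.continuous_ofReal.comp_continuousOn (Complex.continuous_re.comp_continuousOn hHc)
  have hw' : w ∈ Metric.ball (0 : ℂ) |(1 : ℝ)| := by simpa using hw
  have hF' : DiffContOnCl ℂ F (Metric.ball 0 |(1 : ℝ)|) := by simpa using hF
  have i1 : CircleIntegrable (fun ζ => F ζ * ((ζ + w) / (ζ - w))) 0 1 :=
    (hFc.mul hHc).circleIntegrable zero_le_one
  have i2 : CircleIntegrable (fun ζ => (((ζ + w) / (ζ - w)).re : ℂ) * F ζ) 0 1 :=
    (hHrc.mul hFc).circleIntegrable zero_le_one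
  have i3 : CircleIntegrable F 0 1 := hFc.circleIntegrable zero_le_one
  have hdiv : ContinuousOn (fun ζ : ℂ => ζ / (ζ - w)) (Metric.sphere 0 1) :=
    ContinuousOn.div (by fun_prop) (by fun_prop) hne
  have i4 : CircleIntegrable (fun ζ => ζ / (ζ - w) * F ζ) 0 1 :=
    (hdiv.mul hFc).circleIntegrable zero_le_one
  have a1 : Real.circleAverage (fun ζ => ζ / (ζ - w) * F ζ) 0 1 = F w := by
    simpa using hF'.circleAverage_smul_div hw'
  have a2 : Real.circleAverage F 0 1 = F 0 := hF'.circleAverage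
  have a3 : Real.circleAverage (fun ζ => (((ζ + w) / (ζ - w)).re : ℂ) * F ζ) 0 1 = F w := by
    simpa using hF.circleAverage_re_herglotzRieszKernel_smul' hw
  have a4 : Real.circleAverage (fun ζ => F ζ * ((ζ + w) / (ζ - w))) 0 1 = 2 * F w - F 0 := by
    have : Real.circleAverage (fun ζ => (2 : ℝ) • (ζ / (ζ - w) * F ζ) - F ζ) 0 1 =
        2 * F w - F 0 := by
      have i4' : CircleIntegrable (fun ζ => (2 : ℝ) • (ζ / (ζ - w) * F ζ)) 0 1 :=
        ((hdiv.mul hFc).const_smul (2 : ℝ)).circleIntegrable zero_le_one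
      rw [Real.circleAverage_fun_sub i4' i3, Real.circleAverage_fun_smul, a1, a2]
      simp
    rw [← this]
    refine Real.circleAverage_congr_sphere fun ζ hζ => ?_
    have := hne ζ (by simpa using hζ)
    simp only [Complex.real_smul, Complex.ofReal_ofNat]
    field_simp
    ring
  have i2' : CircleIntegrable (fun ζ => (2 : ℝ) • ((((ζ + w) / (ζ - w)).re : ℂ) * F ζ)) 0 1 :=
    ((hHrc.mul hFc).const_smul (2 : ℝ)).circleIntegrable zero_le_one
  set D : ℂ → ℂ := fun ζ => (2 : ℝ) • ((((ζ + w) / (ζ - w)).re : ℂ) * F ζ) -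
    F ζ * ((ζ + w) / (ζ - w)) with hD
  have hDc : ContinuousOn D (Metric.sphere 0 1) :=
    ((hHrc.mul hFc).const_smul (2 : ℝ)).sub (hFc.mul hHc)
  have i5 : CircleIntegrable D 0 1 := hDc.circleIntegrable zero_le_one
  have a5 : Real.circleAverage D 0 1 = F 0 := by
    rw [hD, Real.circleAverage_fun_sub i2' i1, Real.circleAverage_fun_smul, a3, a4]
    simp
  have a6 := Complex.conjCLE.toContinuousLinearMap.circleAverage_comp_comm i5
  rw [a5] at a6
  have i6 : CircleIntegrable (fun ζ => Complex.conjCLE.toContinuousLinearMap (D ζ)) 0 1 :=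
    (Complex.conjCLE.toContinuousLinearMap.continuous.comp_continuousOn hDc).circleIntegrable
      zero_le_one
  have a6' : Real.circleAverage (fun ζ => Complex.conjCLE.toContinuousLinearMap (D ζ)) 0 1 =
    Complex.conjCLE.toContinuousLinearMap (F 0) := a6
  have hsplit : (fun ζ => ((F ζ).re : ℂ) * ((ζ + w) / (ζ - w))) = fun ζ => (2⁻¹ : ℝ) •
      (F ζ * ((ζ + w) / (ζ - w)) + Complex.conjCLE.toContinuousLinearMap (D ζ)) :=
    funext fun ζ => ofReal_re_mul_eq _ _
  rw [hsplit, Real.circleAverage_fun_smul, Real.circleAverage_fun_add i1 i6, a4, a6']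
  apply Complex.ext <;> simp <;> ring

/-- The **Herglotz–Riesz theorem**: the measures `Re F(rζ) |dζ| / 2π` have a weak limit point as
`r → 1`, because finite measures of bounded mass on the circle form a compact set. -/
theorem exists_measure_herglotzRiesz {F : ℂ → ℂ} (hF : DifferentiableOn ℂ F (Metric.ball 0 1))
    (hF0 : ∀ w ∈ Metric.ball (0 : ℂ) 1, 0 ≤ (F w).re) :
    ∃ μ : FiniteMeasure (Metric.sphere (0 : ℂ) 1), ∀ w ∈ Metric.ball (0 : ℂ) 1,
      F w = Complex.I * (F 0).im +
        ∫ ζ, ((ζ : ℂ) + w) / (ζ - w) ∂(μ : Measure (Metric.sphere (0 : ℂ) 1)) := by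
  set r : ℕ → ℝ := fun n => 1 - 1 / ((n : ℝ) + 1) with hr
  have hr0 : ∀ n, 0 ≤ r n := fun n => by
    have : 1 / ((n : ℝ) + 1) ≤ 1 := by
      rw [div_le_one (by positivity)]
      simp
    simp only [hr]
    linarith
  have hr1 : ∀ n, r n < 1 := fun n => by
    have : 0 < 1 / ((n : ℝ) + 1) := by positivity
    simp only [hr]
    linarith
  have hrt : Tendsto r atTop (𝓝 1) := by
    have := (tendsto_one_div_add_atTop_nhds_zero_nat (𝕜 := ℝ)).const_sub 1
    rwa [sub_zero] at this
  have hmem : ∀ n, ∀ ζ ∈ Metric.closedBall (0 : ℂ) 1, (r n : ℂ) * ζ ∈ Metric.ball (0 : ℂ) 1 := by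
    intro n ζ hζ
    simp only [mem_ball_zero_iff, mem_closedBall_zero_iff, norm_mul, Complex.norm_real,
      Real.norm_of_nonneg (hr0 n)] at hζ ⊢
    calc r n * ‖ζ‖ ≤ r n * 1 := by gcongr; exact hr0 n
      _ < 1 := by linarith [hr1 n]
  have hFn : ∀ n, DiffContOnCl ℂ (fun ζ => F (r n * ζ)) (Metric.ball 0 1) := by
    intro n
    have : DifferentiableOn ℂ (fun ζ => F (r n * ζ)) (Metric.closedBall 0 1) :=
      hF.comp (by fun_prop) (hmem n)
    refine DifferentiableOn.diffContOnCl ?_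
    rwa [closure_ball _ one_ne_zero]
  have hsub : Metric.sphere (0 : ℂ) 1 ⊆ Metric.closedBall 0 1 := Metric.sphere_subset_closedBall
  choose μ hμ using fun n => exists_finiteMeasure_circleAverage
    (g := fun ζ => (F (r n * ζ)).re)
    (Complex.continuous_re.comp_continuousOn ((hFn n).continuousOn_ball.mono hsub))
    (fun ζ hζ => hF0 _ (hmem n ζ (hsub hζ)))
  have hker : ∀ w ∈ Metric.ball (0 : ℂ) 1,
      ContinuousOn (fun ζ : ℂ => (ζ + w) / (ζ - w)) (Metric.sphere 0 1) := by
    intro w hw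
    refine ContinuousOn.div (by fun_prop) (by fun_prop) fun ζ hζ h => ?_
    rw [sub_eq_zero] at h
    subst h
    simp at hw hζ
    linarith
  have hrep : ∀ n, ∀ w ∈ Metric.ball (0 : ℂ) 1, ∫ ζ, ((ζ : ℂ) + w) / (ζ - w)
      ∂(μ n : Measure (Metric.sphere (0 : ℂ) 1)) = F (r n * w) - Complex.I * (F 0).im := by
    intro n w hw
    rw [hμ n _ (hker w hw), circleAverage_re_mul_herglotzKernel (hFn n) hw, mul_zero]
  have hmass : ∀ n, (μ n).mass ≤ (F 0).re.toNNReal := by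
    intro n
    have h0 := hrep n 0 (by simp)
    have h1 : ∫ ζ, ((ζ : ℂ) + 0) / (ζ - 0) ∂(μ n : Measure (Metric.sphere (0 : ℂ) 1)) =
        ((μ n).mass : ℂ) := by
      have : ∀ ζ : Metric.sphere (0 : ℂ) 1, ((ζ : ℂ) + 0) / (ζ - 0) = 1 := by
        intro ζ
        have : (ζ : ℂ) ≠ 0 := by
          intro h
          have := ζ.2
          simp [h] at this
        simp [this]
      simp only [this]
      rw [integral_const, Complex.real_smul, mul_one]
      rfl
    rw [h1, mul_zero] at h0
    have h2 := congrArg Complex.re h0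
    simp at h2
    rw [← NNReal.coe_le_coe, Real.coe_toNNReal _ (hF0 0 (by simp))]
    exact h2.le
  obtain ⟨ν, -, hν⟩ := (isCompact_setOfPred_finiteMeasure_le_of_compactSpace
    (Metric.sphere (0 : ℂ) 1) (F 0).re.toNNReal).ultrafilter_le_nhds'
      ((Ultrafilter.of (atTop : Filter ℕ)).map μ)
      (Ultrafilter.mem_map.mpr (Filter.Eventually.of_forall hmass))
  have hν' : Tendsto μ (Ultrafilter.of (atTop : Filter ℕ)) (𝓝 ν) := hν
  rw [FiniteMeasure.tendsto_iff_forall_integral_rclike_tendsto ℂ] at hν'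
  refine ⟨ν, fun w hw => ?_⟩
  have hφ : Continuous fun ζ : Metric.sphere (0 : ℂ) 1 => ((ζ : ℂ) + w) / (ζ - w) :=
    continuousOn_iff_continuous_domRestrict.mp (hker w hw)
  have h1 := hν' (BoundedContinuousFunction.mkOfCompact ⟨_, hφ⟩)
  simp only [BoundedContinuousFunction.mkOfCompact_apply, ContinuousMap.coe_mk, hrep _ w hw] at h1
  have h2 : Tendsto (fun n => F (r n * w) - Complex.I * (F 0).im) atTop
      (𝓝 (F w - Complex.I * (F 0).im)) := by
    have h3 : ContinuousAt F w := (hF.differentiableAt (Metric.isOpen_ball.mem_nhds hw)).continuousAt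
    have h4 : Tendsto (fun n => (r n : ℂ) * w) atTop (𝓝 w) := by
      have := ((Complex.continuous_ofReal.tendsto _).comp hrt).mul_const w
      simpa using this
    exact (h3.tendsto.comp h4).sub_const _
  have h5 := tendsto_nhds_unique h1 (h2.mono_left (Ultrafilter.of_le _))
  rw [h5]
  ring

/-! ### The Nevanlinna representation on the half-plane -/

/-- The Cayley transform from the punctured unit circle to the real line; it takes the junk
value `0` at `1`. -/
noncomputable def circleToLine (ζ : ℂ) : ℝ := (Complex.I * (1 + ζ) / (1 - ζ)).re

lemma ofReal_circleToLine {ζ : ℂ} (hζ : ζ ∈ Metric.sphere (0 : ℂ) 1) (h1 : ζ ≠ 1) :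
    (circleToLine ζ : ℂ) = Complex.I * (1 + ζ) / (1 - ζ) := by
  have hn : ‖ζ‖ = 1 := by simpa using hζ
  have h0 : ζ ≠ 0 := by
    intro h
    simp [h] at hn
  have hconj : (starRingEnd ℂ) ζ = ζ⁻¹ := (Complex.inv_eq_conj hn).symm
  refine Complex.conj_eq_iff_re.mp ?_
  have h2 : 1 - ζ ≠ 0 := sub_ne_zero.mpr (Ne.symm h1)
  have h3 : 1 - ζ⁻¹ ≠ 0 := by
    rw [sub_ne_zero]
    intro h
    exact h1 (by rw [← inv_inv ζ, ← h, inv_one])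
  rw [map_div₀, map_mul, Complex.conj_I, map_add, map_sub, map_one, hconj, div_eq_div_iff h3 h2]
  field_simp
  ring

lemma measurable_circleToLine : Measurable circleToLine := by
  unfold circleToLine
  fun_prop

/-- The Cayley transform turns the Herglotz kernel of the disk into that of the half-plane. -/
lemma herglotzKernel_circleToLine {ζ z : ℂ} (hζ : ζ ∈ Metric.sphere (0 : ℂ) 1) (h1 : ζ ≠ 1)
    (hz : 0 < z.im) :
    Complex.I * ((ζ + (z - Complex.I) / (z + Complex.I)) /
      (ζ - (z - Complex.I) / (z + Complex.I))) =
    (1 + circleToLine ζ ^ 2 : ℝ) • (1 / ((circleToLine ζ : ℂ) - z) -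
      (circleToLine ζ : ℂ) / (1 + (circleToLine ζ : ℂ) ^ 2)) := by
  have ht := ofReal_circleToLine hζ h1
  generalize circleToLine ζ = t at ht ⊢
  have h2 : 1 - ζ ≠ 0 := sub_ne_zero.mpr (Ne.symm h1)
  have h3 := ofReal_sub_ne_zero hz.ne' t
  have h4 := one_add_ofReal_sq_ne_zero t
  have h5 : z + Complex.I ≠ 0 := by
    intro h
    have := congrArg Complex.im h
    simp at this
    linarith
  have h6 : (t : ℂ) + Complex.I ≠ 0 := by
    intro h
    have := congrArg Complex.im h
    simp at this
  have hζt : ζ = (t - Complex.I) / (t + Complex.I) := by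
    rw [eq_div_iff h6]
    rw [eq_div_iff h2] at ht
    linear_combination -ht
  have h7 : ((t : ℂ) - Complex.I) / (t + Complex.I) - (z - Complex.I) / (z + Complex.I) =
      2 * Complex.I * (t - z) / ((t + Complex.I) * (z + Complex.I)) := by
    field_simp
    ring
  have h8 : ((t : ℂ) - Complex.I) / (t + Complex.I) + (z - Complex.I) / (z + Complex.I) =
      2 * (t * z + 1) / ((t + Complex.I) * (z + Complex.I)) := by
    field_simp
    linear_combination -2 * Complex.I_sq
  rw [hζt, h7, h8, Complex.real_smul]
  push_cast
  field_simp
  ring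

/-- The **Nevanlinna representation**: every Herglotz–Nevanlinna function has an integral
representation. The mass at the point `1` of the circle becomes the constant `b`. -/
theorem IsHerglotzNevanlinna.exists_integralRepresentation {m : ℂ → ℂ}
    (hm : IsHerglotzNevanlinna m) :
    ∃ (ρ : Measure ℝ) (a b : ℝ), HasIntegralRepresentation m a b ρ := by
  set F : ℂ → ℂ := fun w => -Complex.I * m (Complex.I * (1 + w) / (1 - w)) with hFdef
  have hne : ∀ w ∈ Metric.ball (0 : ℂ) 1, 1 - w ≠ 0 := by
    intro w hw h
    rw [sub_eq_zero] at h
    subst h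
    simp at hw
  have him : ∀ w ∈ Metric.ball (0 : ℂ) 1, 0 < (Complex.I * (1 + w) / (1 - w)).im := by
    intro w hw
    have hn : ‖w‖ < 1 := by simpa using hw
    have hsq : Complex.normSq w < 1 := by
      rw [Complex.normSq_eq_norm_sq]
      nlinarith [norm_nonneg w]
    have h2 : 0 < Complex.normSq (1 - w) := Complex.normSq_pos.mpr (hne w hw)
    have : (Complex.I * (1 + w) / (1 - w)).im = (1 - Complex.normSq w) / Complex.normSq (1 - w) := by
      rw [Complex.div_im, ← sub_div]
      congr 1
      simp [Complex.normSq_apply]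
      ring
    rw [this]
    exact div_pos (by linarith) h2
  have hFd : DifferentiableOn ℂ F (Metric.ball 0 1) := by
    refine DifferentiableOn.const_mul (hm.differentiableOn.comp ?_ fun w hw => (him w hw).ne') _
    exact DifferentiableOn.div (by fun_prop) (by fun_prop) hne
  have hF0 : ∀ w ∈ Metric.ball (0 : ℂ) 1, 0 ≤ (F w).re := by
    intro w hw
    simpa [hFdef] using hm.im_nonneg _ (him w hw)
  obtain ⟨μ, hμ⟩ := exists_measure_herglotzRiesz hFd hF0
  -- The measure on the circle without its mass at `1` is moved to the line; the density
  -- `1 + t ^ 2` compensates the factor in `herglotzKernel_circleToLine`.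
  set one : Metric.sphere (0 : ℂ) 1 := ⟨1, by simp⟩ with hone
  set T : Metric.sphere (0 : ℂ) 1 → ℝ := fun ζ => circleToLine ζ with hT
  have hTm : Measurable T := measurable_circleToLine.comp measurable_subtype_coe
  set ν : Measure ℝ := ((μ : Measure (Metric.sphere (0 : ℂ) 1)).restrict {one}ᶜ).map T with hν
  have hνfin : IsFiniteMeasure ν := by
    rw [hν]
    infer_instance
  have hdm : Measurable fun t : ℝ => ENNReal.ofReal (1 + t ^ 2) := by fun_prop
  have hpos : ∀ t : ℝ, 0 < 1 + t ^ 2 := fun t => by positivity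
  have hρg : Integrable (fun t : ℝ => 1 / (1 + t ^ 2))
      (ν.withDensity fun t => ENNReal.ofReal (1 + t ^ 2)) := by
    rw [integrable_withDensity_iff_integrable_smul' hdm (by simp)]
    refine (integrable_const (1 : ℝ)).congr (.of_forall fun t => ?_)
    simp only
    rw [ENNReal.toReal_ofReal (hpos t).le, smul_eq_mul, mul_one_div_cancel (hpos t).ne']
  have hupper : ∀ z : ℂ, 0 < z.im → m z = ((-(F 0).im : ℝ) : ℂ) +
      (((μ : Measure (Metric.sphere (0 : ℂ) 1)).real {one} : ℝ) : ℂ) * z +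
      ∫ t : ℝ, (1 / ((t : ℂ) - z) - (t : ℂ) / (1 + (t : ℂ) ^ 2))
        ∂(ν.withDensity fun t => ENNReal.ofReal (1 + t ^ 2)) := by
    intro z hz
    set w : ℂ := (z - Complex.I) / (z + Complex.I) with hw
    have h5 : z + Complex.I ≠ 0 := by
      intro h
      have := congrArg Complex.im h
      simp at this
      linarith
    have hwb : w ∈ Metric.ball (0 : ℂ) 1 := by
      rw [mem_ball_zero_iff, hw, norm_div, div_lt_one (norm_pos_iff.mpr h5), ← sq_lt_sq₀
        (norm_nonneg _) (norm_nonneg _), ← Complex.normSq_eq_norm_sq, ← Complex.normSq_eq_norm_sq]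
      simp [Complex.normSq_apply]
      nlinarith
    have hzw : Complex.I * (1 + w) / (1 - w) = z := by
      rw [div_eq_iff (hne w hwb), hw]
      field_simp
      ring
    have hmz : m z = Complex.I * F w := by
      simp only [hFdef, hzw]
      rw [← mul_assoc, mul_neg, Complex.I_mul_I, neg_neg, one_mul]
    have hker : Integrable
        (fun ζ : Metric.sphere (0 : ℂ) 1 => Complex.I * (((ζ : ℂ) + w) / (ζ - w)))
        (μ : Measure (Metric.sphere (0 : ℂ) 1)) := by
      have hc : Continuous fun ζ : Metric.sphere (0 : ℂ) 1 =>
          Complex.I * (((ζ : ℂ) + w) / (ζ - w)) := by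
        refine continuous_const.mul (Continuous.div (by fun_prop) (by fun_prop) fun ζ h => ?_)
        have := ζ.2
        rw [sub_eq_zero] at h
        rw [h] at this
        simp at this hwb
        linarith
      exact hc.integrable_of_hasCompactSupport (HasCompactSupport.of_compactSpace _)
    rw [hmz, hμ w hwb, mul_add, ← mul_assoc, Complex.I_mul_I, ← integral_const_mul,
      ← integral_add_compl (measurableSet_singleton one) hker, integral_singleton,
      integral_withDensity_eq_integral_toReal_smul hdm (by simp), hν,
      integral_map hTm.aemeasurable (by
        exact (by fun_prop : Measurable _).aestronglyMeasurable), ← add_assoc]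
    congr 1
    · congr 1
      · push_cast
        ring
      · rw [Complex.real_smul]
        congr 1
        rw [← mul_div_assoc]
        exact hzw
    · refine setIntegral_congr_fun (measurableSet_singleton one).compl fun ζ hζ => ?_
      have hζ1 : (ζ : ℂ) ≠ 1 := fun h => hζ (Subtype.ext h)
      rw [ENNReal.toReal_ofReal (hpos _).le]
      exact herglotzKernel_circleToLine ζ.2 hζ1 hz
  refine ⟨ν.withDensity fun t => ENNReal.ofReal (1 + t ^ 2), -(F 0).im,
    (μ : Measure (Metric.sphere (0 : ℂ) 1)).real {one},
    ⟨ENNReal.toReal_nonneg, hρg, fun z hz => ?_⟩⟩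
  rcases lt_or_gt_of_ne hz with hz' | hz'
  · have h1 := hupper ((starRingEnd ℂ) z) (by simpa using hz')
    have h2 := hm.symm ((starRingEnd ℂ) z) (by simpa using hz)
    rw [Complex.conj_conj] at h2
    rw [← h2, h1, map_add, map_add, ← integral_conj]
    simp [Measure.real]
  · exact hupper z hz'

/-- The chosen measure represents the function. -/
lemma IsHerglotzNevanlinna.hasIntegralRepresentation_representingMeasure {m : ℂ → ℂ}
    (hm : IsHerglotzNevanlinna m) :
    ∃ a b : ℝ, HasIntegralRepresentation m a b (representingMeasure m) := by
  have h := hm.exists_integralRepresentation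
  rw [representingMeasure, dif_pos h]
  exact h.choose_spec

/-! ### Rational functions and Herglotz–Nevanlinna functions -/

lemma ofReal_mul_I_im_ne_zero {y : ℝ} (hy : 0 < y) : ((y : ℂ) * Complex.I).im ≠ 0 := by
  simpa using hy.ne'

namespace IsRationalOffReal

variable {f g : ℂ → ℂ}

lemma congr (hf : IsRationalOffReal f) (h : ∀ z : ℂ, z.im ≠ 0 → g z = f z) :
    IsRationalOffReal g := by
  obtain ⟨P, Q, hPQ⟩ := hf
  exact ⟨P, Q, fun z hz => ⟨(hPQ z hz).1, by rw [h z hz, (hPQ z hz).2]⟩⟩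

lemma const (c : ℂ) : IsRationalOffReal fun _ => c :=
  ⟨Polynomial.C c, 1, fun z _ => by simp⟩

lemma linear_add (hf : IsRationalOffReal f) (c d : ℂ) :
    IsRationalOffReal fun z => c * z + d + f z := by
  obtain ⟨P, Q, hPQ⟩ := hf
  refine ⟨(Polynomial.C c * Polynomial.X + Polynomial.C d) * Q + P, Q, fun z hz => ?_⟩
  obtain ⟨h1, h2⟩ := hPQ z hz
  refine ⟨h1, ?_⟩
  simp only [h2, Polynomial.eval_add, Polynomial.eval_mul, Polynomial.eval_C, Polynomial.eval_X]
  field_simp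

lemma neg_inv_of_ne_zero (hf : IsRationalOffReal f) (h0 : ∀ z : ℂ, z.im ≠ 0 → f z ≠ 0) :
    IsRationalOffReal fun z => -(f z)⁻¹ := by
  obtain ⟨P, Q, hPQ⟩ := hf
  refine ⟨-Q, P, fun z hz => ?_⟩
  obtain ⟨h1, h2⟩ := hPQ z hz
  have h3 := h0 z hz
  rw [h2] at h3
  refine ⟨fun h => h3 (by rw [h, zero_div]), ?_⟩
  simp only [h2, inv_div, Polynomial.eval_neg, neg_div]

end IsRationalOffReal

namespace IsHerglotzNevanlinna

variable {f g : ℂ → ℂ}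

lemma congr (hf : IsHerglotzNevanlinna f) (h : ∀ z : ℂ, z.im ≠ 0 → g z = f z) :
    IsHerglotzNevanlinna g where
  differentiableOn := hf.differentiableOn.congr h
  im_nonneg z hz := by
    rw [h z hz.ne']
    exact hf.im_nonneg z hz
  symm z hz := by
    rw [h z hz, h _ (by simpa using hz)]
    exact hf.symm z hz

lemma const (c : ℝ) : IsHerglotzNevanlinna fun _ => (c : ℂ) where
  differentiableOn := differentiableOn_const _
  im_nonneg z _ := by simp
  symm z _ := by simp

lemma linear_add (hf : IsHerglotzNevanlinna f) {c : ℝ} (hc : 0 ≤ c) (d : ℝ) :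
    IsHerglotzNevanlinna fun z => c * z + d + f z where
  differentiableOn := DifferentiableOn.add (by fun_prop) hf.differentiableOn
  im_nonneg z hz := by
    have := hf.im_nonneg z hz
    simp only [Complex.add_im, Complex.mul_im, Complex.ofReal_re, Complex.ofReal_im, zero_mul,
      add_zero]
    positivity
  symm z hz := by
    simp [hf.symm z hz]

/-- A Herglotz–Nevanlinna function whose imaginary part vanishes at one point of the upper
half-plane is a real constant, as the representing measure vanishes. -/
lemma im_pos_or_eq_const (hf : IsHerglotzNevanlinna f) :
    (∀ z : ℂ, 0 < z.im → 0 < (f z).im) ∨ ∃ a : ℝ, ∀ z : ℂ, z.im ≠ 0 → f z = a := by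
  by_cases h : ∀ z : ℂ, 0 < z.im → 0 < (f z).im
  · exact Or.inl h
  right
  push Not at h
  obtain ⟨z, hz, hfz⟩ := h
  obtain ⟨ρ, a, b, hr⟩ := hf.exists_integralRepresentation
  have him := hr.im_eq hz.ne'
  have hpos : ∀ t : ℝ, 0 < z.im / Complex.normSq (t - z) := fun t =>
    div_pos hz (Complex.normSq_pos.mpr (ofReal_sub_ne_zero hz.ne' t))
  have hI : 0 ≤ ∫ t : ℝ, z.im / Complex.normSq (t - z) ∂ρ :=
    integral_nonneg fun t => (hpos t).le
  have hbz : 0 ≤ b * z.im := mul_nonneg hr.b_nonneg hz.le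
  have hb : b = 0 := by
    have : b * z.im = 0 := by linarith
    exact (mul_eq_zero.mp this).resolve_right hz.ne'
  have hI0 : ∫ t : ℝ, z.im / Complex.normSq (t - z) ∂ρ = 0 := by linarith
  have hρ : ρ = 0 := by
    rw [integral_eq_zero_iff_of_nonneg (fun t => (hpos t).le) (hr.integrable_im hz.ne')] at hI0
    have : ∀ᵐ _ : ℝ ∂ρ, False := hI0.mono fun t ht => (hpos t).ne' ht
    rwa [Filter.eventually_false_iff_eq_bot, ae_eq_bot] at this
  refine ⟨a, fun w hw => ?_⟩
  rw [hr.eq_integral w hw, hb, hρ]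
  simp

lemma eq_const_or_ne_zero (hf : IsHerglotzNevanlinna f) :
    (∀ z : ℂ, z.im ≠ 0 → f z ≠ 0) ∨ ∃ a : ℝ, ∀ z : ℂ, z.im ≠ 0 → f z = a := by
  refine hf.im_pos_or_eq_const.imp_left fun h z hz h0 => ?_
  rcases lt_or_gt_of_ne hz with hz' | hz'
  · have h1 := h ((starRingEnd ℂ) z) (by simpa using hz')
    rw [← hf.symm z hz, h0] at h1
    simp at h1
  · have h1 := h z hz'
    rw [h0] at h1
    simp at h1

/-- This includes the case `f = 0`, where the function is `0` by the convention `0⁻¹ = 0`. -/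
lemma neg_inv (hf : IsHerglotzNevanlinna f) : IsHerglotzNevanlinna fun z => -(f z)⁻¹ := by
  rcases hf.eq_const_or_ne_zero with h | ⟨a, ha⟩
  · refine ⟨(hf.differentiableOn.inv h).neg, fun z hz => ?_, fun z hz => ?_⟩
    · rw [Complex.neg_im, Complex.inv_im, neg_div, neg_neg]
      exact div_nonneg (hf.im_nonneg z hz) (Complex.normSq_nonneg _)
    · rw [map_neg, map_inv₀, hf.symm z hz]
  · refine (const (-a⁻¹)).congr fun z hz => ?_
    rw [ha z hz]
    push_cast
    rfl

lemma isRationalOffReal_neg_inv (hf : IsHerglotzNevanlinna f) (hr : IsRationalOffReal f) :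
    IsRationalOffReal fun z => -(f z)⁻¹ := by
  rcases hf.eq_const_or_ne_zero with h | ⟨a, ha⟩
  · exact hr.neg_inv_of_ne_zero h
  · refine (IsRationalOffReal.const (-(a : ℂ)⁻¹)).congr fun z hz => ?_
    rw [ha z hz]

lemma not_isRationalOffReal_neg_inv (hf : IsHerglotzNevanlinna f) (hr : ¬ IsRationalOffReal f) :
    ¬ IsRationalOffReal fun z => -(f z)⁻¹ := by
  intro h
  refine hr ((hf.neg_inv.isRationalOffReal_neg_inv h).congr fun z _ => ?_)
  rw [inv_neg, neg_neg, inv_inv]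

lemma exists_tendsto_div (hf : IsHerglotzNevanlinna f) :
    ∃ b : ℝ, 0 ≤ b ∧
      Tendsto (fun y : ℝ => f (y * Complex.I) / (y * Complex.I)) atTop (𝓝 (b : ℂ)) := by
  obtain ⟨ρ, a, b, hr⟩ := hf.exists_integralRepresentation
  exact ⟨b, hr.b_nonneg, hr.tendsto_div⟩

/-- The linear term of the expansion at `i ∞` can be subtracted. -/
lemma sub_linear (hf : IsHerglotzNevanlinna f) {c : ℝ}
    (hc : Tendsto (fun y : ℝ => f (y * Complex.I) / (y * Complex.I)) atTop (𝓝 (c : ℂ))) (d : ℝ) :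
    IsHerglotzNevanlinna fun z => f z - c * z - d where
  differentiableOn := (hf.differentiableOn.sub (by fun_prop)).sub_const _
  im_nonneg z hz := by
    obtain ⟨ρ, a, b, hr⟩ := hf.exists_integralRepresentation
    have hb : b = c := by exact_mod_cast tendsto_nhds_unique hr.tendsto_div hc
    have h1 := hr.im_eq hz.ne'
    have hI : 0 ≤ ∫ t : ℝ, z.im / Complex.normSq (t - z) ∂ρ :=
      integral_nonneg fun t => div_nonneg hz.le (Complex.normSq_nonneg _)
    simp only [Complex.sub_im, Complex.mul_im, Complex.ofReal_re, Complex.ofReal_im, zero_mul,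
      add_zero, sub_zero]
    rw [h1, hb]
    linarith
  symm z hz := by
    simp [hf.symm z hz]

/-- Up to the sign, a finite limit of `z f(z)` at `i ∞` is the total mass of the representing
measure, which is not zero. -/
lemma lim_mul_neg (hf : IsHerglotzNevanlinna f) (hr : ¬ IsRationalOffReal f) {c : ℝ}
    (hc : Tendsto (fun y : ℝ => (y * Complex.I) * f (y * Complex.I)) atTop (𝓝 (c : ℂ))) :
    c < 0 := by
  obtain ⟨ρ, a, b, hrep⟩ := hf.exists_integralRepresentation
  have hIm : 0 < (f Complex.I).im := by
    rcases hf.im_pos_or_eq_const with h | ⟨a, ha⟩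
    · exact h Complex.I (by simp)
    · exact absurd ((IsRationalOffReal.const (a : ℂ)).congr ha) hr
  have hre := (Complex.continuous_re.tendsto _).comp hc
  -- `y * Im f(iy)` increases with `y`, so the limit is bounded by the value at `y = 1`.
  have hle : c ≤ -(f Complex.I).im := by
    refine le_of_tendsto hre ?_
    filter_upwards [eventually_ge_atTop 1] with y hy
    have hy0 : 0 < y := by linarith
    have hz := ofReal_mul_I_im_ne_zero hy0
    have h1 := hrep.im_eq (z := Complex.I) (by simp)
    have h2 := hrep.im_eq hz
    have i1 := hrep.integrable_im (z := Complex.I) (by simp)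
    have i2 := (hrep.integrable_im hz).const_mul y
    have h3 : ∫ t : ℝ, Complex.I.im / Complex.normSq (t - Complex.I) ∂ρ ≤
        y * ∫ t : ℝ, ((y : ℂ) * Complex.I).im / Complex.normSq (t - y * Complex.I) ∂ρ := by
      rw [← integral_const_mul]
      refine integral_mono i1 i2 fun t => ?_
      simp [Complex.normSq_apply]
      rw [← mul_div_assoc, inv_eq_one_div,
        div_le_div_iff₀ (by nlinarith) (by nlinarith)]
      have : 1 ≤ y * y := by nlinarith
      nlinarith [mul_self_nonneg t]
    have h4 : b ≤ y * (b * y) := by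
      have : 1 ≤ y * y := by nlinarith
      nlinarith [hrep.b_nonneg]
    have h5 : (((y : ℂ) * Complex.I) * f (y * Complex.I)).re = -(y * (f (y * Complex.I)).im) := by
      simp
    simp only [Function.comp]
    rw [h5, h1, h2]
    simp only [Complex.mul_im, Complex.ofReal_re, Complex.I_im, Complex.ofReal_im, Complex.I_re,
      mul_one, mul_zero, add_zero] at h3 ⊢
    linarith
  linarith

end IsHerglotzNevanlinna

/-! ### From continued fractions to asymptotic expansions -/

lemma continuedFractionFrom_succ (υ ω l : ℕ → ℝ) (z w : ℂ) (j n : ℕ) :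
    continuedFractionFrom υ ω l z w j (n + 1) =
      continuedFractionFrom (fun k => υ (k + 1)) (fun k => ω (k + 1)) (fun k => l (k + 1))
        z w j n := by
  induction j generalizing n with
  | zero => rfl
  | succ j ih => rw [continuedFractionFrom, continuedFractionFrom, ih]

/-- Splitting off the first level of a continued fraction. -/
lemma continuedFraction_succ (υ ω l : ℕ → ℝ) (N : ℕ) (z w : ℂ) :
    continuedFraction υ ω l (N + 1) z w = υ 0 * z + ω 0 + -(l 1 * z + 0 +
      -(continuedFraction (fun k => υ (k + 1)) (fun k => ω (k + 1)) (fun k => l (k + 1))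
        N z w)⁻¹)⁻¹ := by
  rw [continuedFraction, continuedFractionFrom, continuedFractionFrom_succ, continuedFraction,
    one_div, one_div, ← inv_neg]
  congr 2
  ring

/-- The order of a continued fraction with `N` levels: the number `N` of its `l n`, plus the number
of its nonzero `υ n`, `1 ≤ n ≤ N`. -/
noncomputable def continuedFractionOrder (υ : ℕ → ℝ) (N : ℕ) : ℕ :=
  N + ((Finset.Icc 1 N).filter fun n => υ n ≠ 0).card

lemma continuedFractionOrder_zero (υ : ℕ → ℝ) : continuedFractionOrder υ 0 = 0 := by
  simp [continuedFractionOrder]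

lemma continuedFractionOrder_succ (υ : ℕ → ℝ) (N : ℕ) :
    continuedFractionOrder υ (N + 1) =
      continuedFractionOrder (fun k => υ (k + 1)) N + if υ 1 = 0 then 1 else 2 := by
  have h : ∀ (υ : ℕ → ℝ) (N : ℕ), ((Finset.Icc 1 N).filter fun n => υ n ≠ 0).card =
      ∑ i ∈ Finset.range N, if υ (i + 1) = 0 then 0 else 1 := by
    intro υ N
    rw [Finset.card_filter, Finset.range_eq_Ico,
      Finset.sum_Ico_add' (fun i => if υ i = 0 then 0 else 1) 0 N 1]
    refine Finset.sum_congr (by ext; simp) fun i _ => ?_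
    split_ifs <;> simp_all
  rw [continuedFractionOrder, continuedFractionOrder, h, h, Finset.sum_range_succ']
  split_ifs <;> simp_all <;> omega

/-- The data of a continued fraction expansion of `f` with `N` levels. -/
structure IsContinuedFraction (f mt : ℂ → ℂ) (N : ℕ) (υ ω l : ℕ → ℝ) : Prop where
  herglotz : IsHerglotzNevanlinna mt
  nonneg : ∀ n, n ≤ N → 0 ≤ υ n
  pos : ∀ n, 1 ≤ n → n ≤ N → 0 < l n
  nondegenerate : ∀ n, 1 ≤ n → n + 1 ≤ N → 0 < υ n + |ω n|
  eq : ∀ z : ℂ, z.im ≠ 0 → f z = continuedFraction υ ω l N z (mt z)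

namespace IsContinuedFraction

variable {f mt : ℂ → ℂ} {N : ℕ} {υ ω l : ℕ → ℝ}

/-- The continued fraction that starts one level further down. -/
lemma tail (h : IsContinuedFraction f mt (N + 1) υ ω l) :
    IsContinuedFraction (fun z => continuedFraction (fun k => υ (k + 1)) (fun k => ω (k + 1))
      (fun k => l (k + 1)) N z (mt z)) mt N (fun k => υ (k + 1)) (fun k => ω (k + 1))
      (fun k => l (k + 1)) where
  herglotz := h.herglotz
  nonneg n hn := h.nonneg _ (by omega)
  pos n hn hn' := h.pos _ (by omega) (by omega)
  nondegenerate n hn hn' := h.nondegenerate _ (by omega) (by omega)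
  eq z _ := rfl

lemma eq_tail (h : IsContinuedFraction f mt (N + 1) υ ω l) {z : ℂ} (hz : z.im ≠ 0) :
    f z = υ 0 * z + ω 0 + -(l 1 * z + 0 + -(continuedFraction (fun k => υ (k + 1))
      (fun k => ω (k + 1)) (fun k => l (k + 1)) N z (mt z))⁻¹)⁻¹ := by
  rw [h.eq z hz, continuedFraction_succ]

/-- The function equals its linear term `υ 0 * z` plus a Herglotz–Nevanlinna function. -/
lemma exists_eq_linear_add (h : IsContinuedFraction f mt N υ ω l) :
    ∃ g : ℂ → ℂ, IsHerglotzNevanlinna g ∧ ∀ z : ℂ, z.im ≠ 0 → f z = υ 0 * z + 0 + g z := by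
  induction N generalizing f υ ω l with
  | zero =>
    refine ⟨mt, h.herglotz, fun z hz => ?_⟩
    rw [h.eq z hz, continuedFraction, continuedFractionFrom, add_zero]
  | succ N ih =>
    obtain ⟨g, hg, hfg⟩ := ih h.tail
    have h1 := (hg.linear_add (h.nonneg 1 (by omega)) 0).congr (by simpa using hfg)
    have h2 := (((h1.neg_inv).linear_add (h.pos 1 le_rfl (by omega)).le 0).neg_inv).linear_add
      le_rfl (ω 0)
    refine ⟨_, h2, fun z hz => ?_⟩
    rw [h.eq_tail hz]
    push_cast
    ring

lemma isHerglotzNevanlinna (h : IsContinuedFraction f mt N υ ω l) : IsHerglotzNevanlinna f := by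
  obtain ⟨g, hg, hfg⟩ := h.exists_eq_linear_add
  exact (hg.linear_add (h.nonneg 0 (by omega)) 0).congr (by simpa using hfg)

lemma not_isRationalOffReal_tail (h : IsContinuedFraction f mt (N + 1) υ ω l)
    (hf : ¬ IsRationalOffReal f) :
    ¬ IsRationalOffReal fun z => continuedFraction (fun k => υ (k + 1)) (fun k => ω (k + 1))
      (fun k => l (k + 1)) N z (mt z) := by
  intro hr
  have h1 := h.tail.isHerglotzNevanlinna
  have h2 := (h1.isRationalOffReal_neg_inv hr).linear_add (l 1) 0
  have h3 : IsHerglotzNevanlinna _ := h1.neg_inv.linear_add (h.pos 1 le_rfl (by omega)).le 0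
  refine hf (((h3.isRationalOffReal_neg_inv (by simpa using h2)).linear_add (υ 0) (ω 0)).congr
    fun z hz => ?_)
  rw [h.eq_tail hz]
  simp

end IsContinuedFraction

section Asymptotics

variable {h : ℂ → ℂ} {l : ℝ}

lemma tendsto_tail_denominator (hh : IsHerglotzNevanlinna h) (hl : 0 < l) :
    ∃ c : ℝ, 0 < c ∧ Tendsto (fun y : ℝ => (l : ℂ) + h (y * Complex.I) / (y * Complex.I)) atTop
      (𝓝 (c : ℂ)) := by
  obtain ⟨b, hb, hlim⟩ := hh.exists_tendsto_div
  exact ⟨l + b, by linarith, by simpa using hlim.const_add (l : ℂ)⟩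

/-- Two more terms of the expansion are gained by passing from `h` to `-1 / (l z + h)`. -/
lemma hasRealExpansion_tail (hh : IsHerglotzNevanlinna h) (hl : 0 < l) {n : ℕ}
    (hE : HasRealExpansion n (fun y : ℝ => h (y * Complex.I) / (y * Complex.I))) :
    HasRealExpansion (n + 1) (fun y : ℝ =>
      -(l * (y * Complex.I) + 0 + h (y * Complex.I))⁻¹) := by
  obtain ⟨c, hc, hlim⟩ := tendsto_tail_denominator hh hl
  have h1 := ((((HasRealExpansion.const n l).add hE).inv hlim hc.ne').neg).div_mul_I
  refine h1.congr' ?_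
  filter_upwards [HasRealExpansion.eventually_mul_I_ne_zero] with y hy
  rw [add_zero, neg_div, ← one_div_div]
  congr 1
  rw [one_div, inv_div, div_eq_mul_inv, ← mul_inv]
  congr 1
  generalize (y : ℂ) * Complex.I = Z at hy ⊢
  field_simp

lemma tendsto_tail (hh : IsHerglotzNevanlinna h) (hl : 0 < l) :
    Tendsto (fun y : ℝ => -(l * (y * Complex.I) + 0 + h (y * Complex.I))⁻¹) atTop (𝓝 0) := by
  obtain ⟨c, hc, hlim⟩ := tendsto_tail_denominator hh hl
  have hc' : (c : ℂ) ≠ 0 := by exact_mod_cast hc.ne'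
  have h1 := (HasRealExpansion.tendsto_inv_mul_I.mul (hlim.inv₀ hc')).neg
  rw [zero_mul, neg_zero] at h1
  refine h1.congr' ?_
  filter_upwards [HasRealExpansion.eventually_mul_I_ne_zero] with y hy
  rw [← mul_inv, add_zero]
  congr 2
  generalize (y : ℂ) * Complex.I = Z at hy ⊢
  field_simp

end Asymptotics

namespace IsContinuedFraction

variable {f mt : ℂ → ℂ} {N : ℕ} {υ ω l : ℕ → ℝ}

lemma tendsto_sub_linear (h : IsContinuedFraction f mt (N + 1) υ ω l) :
    Tendsto (fun y : ℝ => f (y * Complex.I) - υ 0 * (y * Complex.I)) atTop (𝓝 (ω 0 : ℂ)) := by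
  have h1 := (tendsto_tail h.tail.isHerglotzNevanlinna.neg_inv
    (h.pos 1 le_rfl (by omega))).const_add (ω 0 : ℂ)
  rw [add_zero] at h1
  refine h1.congr' ?_
  filter_upwards [eventually_gt_atTop 0] with y hy
  rw [h.eq_tail (ofReal_mul_I_im_ne_zero hy)]
  ring

/-- A continued fraction expansion of order `D` gives an asymptotic expansion. -/
lemma hasRealExpansion (h : IsContinuedFraction f mt N υ ω l) (hf : ¬ IsRationalOffReal f) :
    HasRealExpansion (2 * continuedFractionOrder υ N)
      (fun y : ℝ => f (y * Complex.I) / (y * Complex.I)) := by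
  induction N generalizing f υ ω l with
  | zero =>
    obtain ⟨b, -, hb⟩ := h.isHerglotzNevanlinna.exists_tendsto_div
    rw [continuedFractionOrder_zero]
    exact ⟨b, hb⟩
  | succ N ih =>
    have hl : 0 < l 1 := h.pos 1 le_rfl (by omega)
    have ht := h.tail
    have htr := h.not_isRationalOffReal_tail hf
    have hIH := ih ht htr
    rw [continuedFractionOrder_succ]
    have heq : ∀ z : ℂ, z.im ≠ 0 → f z = _ := fun z hz => h.eq_tail hz
    set D := continuedFractionOrder (fun k => υ (k + 1)) N with hD
    set g : ℂ → ℂ := fun z => continuedFraction (fun k => υ (k + 1)) (fun k => ω (k + 1))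
      (fun k => l (k + 1)) N z (mt z) with hg
    have hgH : IsHerglotzNevanlinna g := ht.isHerglotzNevanlinna
    -- It remains to gain the right number of terms in passing from `g` to `-1 / g`.
    suffices hsuff : HasRealExpansion (2 * D + if υ 1 = 0 then 0 else 2)
        (fun y : ℝ => -(g (y * Complex.I))⁻¹ / (y * Complex.I)) by
      have h1 := (hasRealExpansion_tail hgH.neg_inv hl hsuff).div_mul_I
      have h2 := (HasRealExpansion.const ((2 * D + if υ 1 = 0 then 0 else 2) + 1) (ω 0)).div_mul_I
      have h3 := ((HasRealExpansion.const _ (υ 0)).add h2).add h1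
      have hn : 2 * (D + if υ 1 = 0 then 1 else 2) =
          (2 * D + if υ 1 = 0 then 0 else 2) + 1 + 1 := by
        split_ifs <;> omega
      rw [hn]
      refine h3.congr' ?_
      filter_upwards [eventually_gt_atTop 0, HasRealExpansion.eventually_mul_I_ne_zero] with y hy hy'
      rw [heq _ (ofReal_mul_I_im_ne_zero hy), add_div, add_div, mul_div_cancel_right₀ _ hy']
    by_cases hυ : υ 1 = 0
    · rw [if_pos hυ, add_zero]
      -- Without a further level `-1 / g` contributes only its linear growth rate; otherwise `g`
      -- tends to `ω 1 ≠ 0`, and dividing by `z` recovers the term lost in `g(z) / z → 0`.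
      cases N with
      | zero =>
        obtain ⟨b, -, hb⟩ := hgH.neg_inv.exists_tendsto_div
        rw [hD, continuedFractionOrder_zero]
        exact ⟨b, hb⟩
      | succ N =>
        have hlim : Tendsto (fun y : ℝ => g (y * Complex.I)) atTop (𝓝 (ω 1 : ℂ)) := by
          simpa [hυ] using ht.tendsto_sub_linear
        have hω : ω 1 ≠ 0 := by
          intro h0
          have := h.nondegenerate 1 le_rfl (by omega)
          simp [hυ, h0] at this
        have hlim0 : Tendsto (fun y : ℝ => g (y * Complex.I) / (y * Complex.I)) atTop
            (𝓝 ((0 : ℝ) : ℂ)) := by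
          simpa [div_eq_mul_inv] using hlim.mul HasRealExpansion.tendsto_inv_mul_I
        obtain ⟨d, hd⟩ : ∃ d, 2 * D = d + 1 := by
          refine ⟨2 * D - 1, ?_⟩
          rw [hD, continuedFractionOrder_succ]
          split_ifs <;> omega
        rw [hd] at hIH ⊢
        have hgE : HasRealExpansion d (fun y : ℝ => g (y * Complex.I)) := by
          refine (hIH.of_succ hlim0).congr' ?_
          filter_upwards [HasRealExpansion.eventually_mul_I_ne_zero] with y hy
          rw [Complex.ofReal_zero, sub_zero, mul_div_cancel₀ _ hy]
        exact (hgE.inv hlim hω).neg.div_mul_I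
    · rw [if_neg hυ]
      obtain ⟨r, hr, hgr⟩ := ht.exists_eq_linear_add
      obtain ⟨b, hb0, hb⟩ := hr.exists_tendsto_div
      have hlim : Tendsto (fun y : ℝ => g (y * Complex.I) / (y * Complex.I)) atTop
          (𝓝 ((υ 1 + b : ℝ) : ℂ)) := by
        rw [Complex.ofReal_add]
        refine (hb.const_add (υ 1 : ℂ)).congr' ?_
        filter_upwards [eventually_gt_atTop 0, HasRealExpansion.eventually_mul_I_ne_zero]
          with y hy hy'
        rw [hgr _ (ofReal_mul_I_im_ne_zero hy), add_zero, add_div, mul_div_cancel_right₀ _ hy']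
      have hne : υ 1 + b ≠ 0 := by
        have : 0 < υ 1 := lt_of_le_of_ne (h.nonneg 1 (by omega)) (Ne.symm hυ)
        positivity
      refine (hIH.inv hlim hne).neg.div_mul_I.div_mul_I.congr' ?_
      filter_upwards [HasRealExpansion.eventually_mul_I_ne_zero] with y hy
      rw [inv_div, neg_div, neg_div, neg_div, div_div_cancel_left' hy]

end IsContinuedFraction

/-! ### From asymptotic expansions to continued fractions -/

/-- The sequence `a, s 0, s 1, …`. -/
def consSeq (a : ℝ) (s : ℕ → ℝ) : ℕ → ℝ
  | 0 => a
  | n + 1 => s n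

/-- Putting a new level in front of a continued fraction; `l 0` does not occur in the expansion
of `g` and becomes the first coefficient `l 1` of the new expansion. -/
lemma IsContinuedFraction.cons {f g mt : ℂ → ℂ} {N : ℕ} {υ ω l : ℕ → ℝ} {a w : ℝ} (l₀ : ℝ)
    (h : IsContinuedFraction g mt N υ ω l) (ha : 0 ≤ a) (hl : 0 < l 0)
    (hN : 1 ≤ N → 0 < υ 0 + |ω 0|)
    (hf : ∀ z : ℂ, z.im ≠ 0 → f z = a * z + w + -(l 0 * z + 0 + -(g z)⁻¹)⁻¹) :
    IsContinuedFraction f mt (N + 1) (consSeq a υ) (consSeq w ω) (consSeq l₀ l) where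
  herglotz := h.herglotz
  nonneg n hn := by
    cases n with
    | zero => exact ha
    | succ n => exact h.nonneg n (by omega)
  pos n hn hn' := by
    obtain ⟨n, rfl⟩ : ∃ k, n = k + 1 := ⟨n - 1, by omega⟩
    cases n with
    | zero => exact hl
    | succ n => exact h.pos _ (by omega) (by omega)
  nondegenerate n hn hn' := by
    obtain ⟨n, rfl⟩ : ∃ k, n = k + 1 := ⟨n - 1, by omega⟩
    cases n with
    | zero => exact hN (by omega)
    | succ n => exact h.nondegenerate _ (by omega) (by omega)
  eq z hz := by
    rw [hf z hz, h.eq z hz, continuedFraction_succ]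
    rfl

/-- One step of the continued fraction algorithm: if `f` has an expansion, then it splits off a
level `f = υ z + ω - 1 / (l z + h)` with `h(z) / z → 0`, at the cost of two terms. -/
lemma IsHerglotzNevanlinna.exists_level {f : ℂ → ℂ} (hf : IsHerglotzNevanlinna f)
    (hr : ¬ IsRationalOffReal f) {d : ℕ}
    (hE : HasRealExpansion (d + 2) (fun y : ℝ => f (y * Complex.I) / (y * Complex.I))) :
    ∃ (υ ω l : ℝ) (h : ℂ → ℂ), 0 ≤ υ ∧ 0 < l ∧ IsHerglotzNevanlinna h ∧ ¬ IsRationalOffReal h ∧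
      Tendsto (fun y : ℝ => f (y * Complex.I) / (y * Complex.I)) atTop (𝓝 (υ : ℂ)) ∧
      Tendsto (fun y : ℝ => f (y * Complex.I) - υ * (y * Complex.I)) atTop (𝓝 (ω : ℂ)) ∧
      Tendsto (fun y : ℝ => h (y * Complex.I) / (y * Complex.I)) atTop (𝓝 ((0 : ℝ) : ℂ)) ∧
      HasRealExpansion d (fun y : ℝ => h (y * Complex.I) / (y * Complex.I)) ∧
      ∀ z : ℂ, z.im ≠ 0 → f z = υ * z + ω + -(l * z + 0 + h z)⁻¹ := by
  obtain ⟨υ, hυ, hυlim⟩ := hf.exists_tendsto_div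
  have hE1 : HasRealExpansion (d + 1) (fun y : ℝ => f (y * Complex.I) - υ * (y * Complex.I)) := by
    refine (hE.of_succ hυlim).congr' ?_
    filter_upwards [HasRealExpansion.eventually_mul_I_ne_zero] with y hy
    rw [mul_sub, mul_div_cancel₀ _ hy, mul_comm (υ : ℂ)]
  obtain ⟨ω, hω⟩ := hE1.exists_tendsto
  have hE2 := hE1.of_succ hω
  obtain ⟨c, hc⟩ := hE2.exists_tendsto
  have hF := hf.sub_linear hυlim ω
  have hFr : ¬ IsRationalOffReal fun z => f z - υ * z - ω := by
    intro h
    refine hr ((h.linear_add υ ω).congr fun z _ => ?_)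
    ring
  have hc0 : c < 0 := hF.lim_mul_neg hFr hc
  -- `h₀ = -1 / F` grows like `l z` with `l = -1 / c`, and `h` is the remainder.
  have hE3 := (hE2.inv hc hc0.ne).neg
  have hlim3 := (hc.inv₀ (by exact_mod_cast hc0.ne)).neg
  have hl : 0 < -c⁻¹ := by
    rw [neg_pos]
    exact inv_lt_zero.mpr hc0
  have heq3 : ∀ᶠ y : ℝ in atTop,
      -(((y : ℂ) * Complex.I) * (f (y * Complex.I) - υ * (y * Complex.I) - ω))⁻¹ =
        -(f (y * Complex.I) - υ * (y * Complex.I) - ω)⁻¹ / (y * Complex.I) :=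
    .of_forall fun y => by
      rw [mul_inv, neg_div, div_eq_mul_inv, mul_comm]
  have hlim4 : Tendsto (fun y : ℝ =>
      -(f (y * Complex.I) - υ * (y * Complex.I) - ω)⁻¹ / (y * Complex.I)) atTop
        (𝓝 ((-c⁻¹ : ℝ) : ℂ)) := by
    push_cast
    exact hlim3.congr' heq3
  have hE4 := hE3.congr' heq3
  have hdiv : ∀ᶠ y : ℝ in atTop,
      -(f (y * Complex.I) - υ * (y * Complex.I) - ω)⁻¹ / (y * Complex.I) + ((-(-c⁻¹) : ℝ) : ℂ) =
        (-(f (y * Complex.I) - υ * (y * Complex.I) - ω)⁻¹ - ((-c⁻¹ : ℝ) : ℂ) * (y * Complex.I) -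
          ((0 : ℝ) : ℂ)) / (y * Complex.I) := by
    filter_upwards [HasRealExpansion.eventually_mul_I_ne_zero] with y hy
    rw [Complex.ofReal_zero, sub_zero, sub_div, mul_div_cancel_right₀ _ hy, Complex.ofReal_neg]
    exact (sub_eq_add_neg _ _).symm
  have hh := hF.neg_inv.sub_linear hlim4 0
  refine ⟨υ, ω, -c⁻¹, _, hυ, hl, hh, ?_, hυlim, hω, ?_, ?_, fun z hz => ?_⟩
  · intro h
    refine hF.not_isRationalOffReal_neg_inv hFr
      ((h.linear_add ((-c⁻¹ : ℝ) : ℂ) 0).congr fun z _ => ?_)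
    push_cast
    ring
  · refine Tendsto.congr' hdiv ?_
    have := hlim4.add_const ((-(-c⁻¹) : ℝ) : ℂ)
    rwa [← Complex.ofReal_add, add_neg_cancel] at this
  · exact (hE4.add (HasRealExpansion.const d (-(-c⁻¹)))).congr' hdiv
  · have h1 : ((-c⁻¹ : ℝ) : ℂ) * z + 0 + (-(f z - υ * z - ω)⁻¹ - ((-c⁻¹ : ℝ) : ℂ) * z -
        ((0 : ℝ) : ℂ)) = -(f z - υ * z - ω)⁻¹ := by
      push_cast
      ring
    rw [h1, inv_neg, inv_inv]
    ring

/-- The continued fraction algorithm: an asymptotic expansion gives a continued fraction expansion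
of the corresponding order. The first coefficients are identified by limits, which shows that they
are not both zero when a level is put in front. -/
theorem IsHerglotzNevanlinna.exists_isContinuedFraction (D : ℕ) {f : ℂ → ℂ}
    (hf : IsHerglotzNevanlinna f) (hr : ¬ IsRationalOffReal f)
    (hE : HasRealExpansion (2 * D) (fun y : ℝ => f (y * Complex.I) / (y * Complex.I))) (l₀ : ℝ) :
    ∃ (mt : ℂ → ℂ) (N : ℕ) (υ ω l : ℕ → ℝ), IsContinuedFraction f mt N υ ω l ∧
      D ≤ continuedFractionOrder υ N ∧ l 0 = l₀ ∧
      Tendsto (fun y : ℝ => f (y * Complex.I) / (y * Complex.I)) atTop (𝓝 (υ 0 : ℂ)) ∧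
      (1 ≤ N →
        Tendsto (fun y : ℝ => f (y * Complex.I) - υ 0 * (y * Complex.I)) atTop (𝓝 (ω 0 : ℂ))) := by
  induction D using Nat.strong_induction_on generalizing f l₀ with
  | _ D ih =>
  rcases D with _ | D
  · obtain ⟨b, hb, hlim⟩ := hf.exists_tendsto_div
    refine ⟨fun z => f z - b * z - (0 : ℝ), 0, fun _ => b, fun _ => 0, fun _ => l₀,
      ⟨hf.sub_linear hlim 0, fun _ _ => hb, fun n hn hn' => by omega, fun n hn hn' => by omega,
        fun z hz => ?_⟩, Nat.zero_le _, rfl, hlim, fun h => by omega⟩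
    simp [continuedFraction, continuedFractionFrom]
  · obtain ⟨υ, ω, l, h, hυ, hl, hh, hhr, hυlim, hωlim, hhlim, hhE, heq⟩ :=
      hf.exists_level hr (d := 2 * D) hE
    have hg := hh.neg_inv
    have hgr := hh.not_isRationalOffReal_neg_inv hhr
    have heq' : ∀ z : ℂ, z.im ≠ 0 → f z = υ * z + ω + -(l * z + 0 + -(-(h z)⁻¹)⁻¹)⁻¹ := by
      intro z hz
      rw [heq z hz, inv_neg, inv_inv, neg_neg]
    -- It suffices to expand `g = -1 / h` to an order that is smaller by one or two.
    suffices hsuff : ∃ (mt : ℂ → ℂ) (N : ℕ) (υ' ω' l' : ℕ → ℝ),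
        IsContinuedFraction (fun z => -(h z)⁻¹) mt N υ' ω' l' ∧
        D + 1 ≤ continuedFractionOrder υ' N + (if υ' 0 = 0 then 1 else 2) ∧ l' 0 = l ∧
        (1 ≤ N → 0 < υ' 0 + |ω' 0|) by
      obtain ⟨mt, N, υ', ω', l', hcf, hD, hl', hN⟩ := hsuff
      refine ⟨mt, N + 1, consSeq υ υ', consSeq ω ω', consSeq l₀ l',
        hcf.cons l₀ hυ (hl' ▸ hl) hN (hl' ▸ heq'), ?_, rfl, hυlim, fun _ => hωlim⟩
      rw [continuedFractionOrder_succ]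
      exact hD
    rcases D with _ | D
    · -- The expansion stops here: `g` is its linear term plus the final function.
      obtain ⟨b, hb, hlim⟩ := hg.exists_tendsto_div
      refine ⟨fun z => -(h z)⁻¹ - b * z - (0 : ℝ), 0, fun _ => b, fun _ => 0, fun _ => l,
        ⟨hg.sub_linear hlim 0, fun _ _ => hb, fun n hn hn' => by omega,
          fun n hn hn' => by omega, fun z hz => ?_⟩, ?_, rfl, fun h => by omega⟩
      · simp [continuedFraction, continuedFractionFrom]
      · split_ifs <;> omega
    · have hE1 : HasRealExpansion (2 * D + 1) (fun y : ℝ => h (y * Complex.I)) := by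
        refine (hhE.of_succ hhlim).congr' ?_
        filter_upwards [HasRealExpansion.eventually_mul_I_ne_zero] with y hy
        rw [Complex.ofReal_zero, sub_zero, mul_div_cancel₀ _ hy]
      obtain ⟨c, hc⟩ := hE1.exists_tendsto
      by_cases hc0 : c = 0
      · -- `z h(z)` has a nonzero limit, so `g` grows linearly: `υ' 0 ≠ 0`.
        subst hc0
        have hE2 : HasRealExpansion (2 * D)
            (fun y : ℝ => (y * Complex.I) * h (y * Complex.I)) := by
          simpa using hE1.of_succ hc
        obtain ⟨s, hs⟩ := hE2.exists_tendsto
        have hs0 := hh.lim_mul_neg hhr hs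
        have hgeq : ∀ᶠ y : ℝ in atTop, -(((y : ℂ) * Complex.I) * h (y * Complex.I))⁻¹ =
            -(h (y * Complex.I))⁻¹ / (y * Complex.I) :=
          .of_forall fun y => by rw [mul_inv, neg_div, div_eq_mul_inv, mul_comm]
        obtain ⟨mt, N, υ', ω', l', hcf, hD, hl', hlim, -⟩ :=
          ih D (by omega) hg hgr ((hE2.inv hs hs0.ne).neg.congr' hgeq) l
        have hυ' : υ' 0 ≠ 0 := by
          have h1 := ((hs.inv₀ (by exact_mod_cast hs0.ne)).neg).congr' hgeq
          have h2 := tendsto_nhds_unique hlim h1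
          have h3 : υ' 0 = -s⁻¹ := by exact_mod_cast h2
          rw [h3]
          exact neg_ne_zero.mpr (inv_ne_zero hs0.ne)
        refine ⟨mt, N, υ', ω', l', hcf, ?_, hl', fun _ => ?_⟩
        · rw [if_neg hυ']
          omega
        · have := lt_of_le_of_ne (hcf.nonneg 0 (by omega)) (Ne.symm hυ')
          positivity
      · -- `g` has a nonzero limit, which is `ω' 0`.
        have hE2 := (hE1.inv hc hc0).neg
        obtain ⟨mt, N, υ', ω', l', hcf, hD, hl', hlim, hlim'⟩ :=
          ih (D + 1) (by omega) hg hgr hE2.div_mul_I l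
        have hglim := (hc.inv₀ (by exact_mod_cast hc0)).neg
        refine ⟨mt, N, υ', ω', l', hcf, ?_, hl', fun hN => ?_⟩
        · split_ifs <;> omega
        · have hυ' : υ' 0 = 0 := by
            have h1 := hglim.mul HasRealExpansion.tendsto_inv_mul_I
            rw [mul_zero] at h1
            simp only [← div_eq_mul_inv] at h1
            exact_mod_cast tendsto_nhds_unique hlim h1
          have hω' : ω' 0 = -c⁻¹ := by
            have h1 := hlim' hN
            simp only [hυ', Complex.ofReal_zero, zero_mul, sub_zero] at h1
            exact_mod_cast tendsto_nhds_unique h1 hglim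
          rw [hυ', hω', zero_add, abs_pos]
          exact neg_ne_zero.mpr (inv_ne_zero hc0)

theorem theorem1p5 (m : ℂ → ℂ) (hm : IsHerglotzNevanlinna m) (hrat : ¬ IsRationalOffReal m)
    (K : ℕ) :
    MomentsExistUpTo (representingMeasure m) (2 * K) ↔
      ∃ (mt : ℂ → ℂ) (N : ℕ) (υ ω l : ℕ → ℝ),
        IsHerglotzNevanlinna mt ∧
        1 ≤ N ∧
        (∀ n, n ≤ N → 0 ≤ υ n) ∧
        (∀ n, 1 ≤ n → n ≤ N → 0 < l n) ∧
        (∀ n, 1 ≤ n → n ≤ N - 1 → 0 < υ n + |ω n|) ∧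
        K ≤ N - 1 + ((Finset.Icc 1 N).filter (fun n => υ n ≠ 0)).card ∧
        ∀ z : ℂ, z.im ≠ 0 → m z = continuedFraction υ ω l N z (mt z) := by
  obtain ⟨a, b, hrep⟩ := hm.hasIntegralRepresentation_representingMeasure
  constructor
  · intro hK
    obtain ⟨mt, N, υ, ω, l, hcf, hD, -⟩ := hm.exists_isContinuedFraction (K + 1) hrat
      (hrep.hasRealExpansion_of_moments hK) 0
    have hN : 1 ≤ N := by
      by_contra hN
      obtain rfl : N = 0 := by omega
      rw [continuedFractionOrder_zero] at hD
      omega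
    rw [continuedFractionOrder] at hD
    exact ⟨mt, N, υ, ω, l, hcf.herglotz, hN, hcf.nonneg, hcf.pos,
      fun n hn hn' => hcf.nondegenerate n hn (by omega), by omega, hcf.eq⟩
  · rintro ⟨mt, N, υ, ω, l, hmt, hN, hυ, hl, hnd, hK, heq⟩
    have hcf : IsContinuedFraction m mt N υ ω l :=
      ⟨hmt, hυ, hl, fun n hn hn' => hnd n hn (by omega), heq⟩
    refine hrep.moments_of_hasRealExpansion ((hcf.hasRealExpansion hrat).mono ?_)
    rw [continuedFractionOrder]
    omega
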